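/- Let $\mathcal T$ be the set of unlabelled non-planar rooted trees, including the empty tree $\emptyset$; write $|\tau|$ for the number of vertices and $\sigma(\tau)$ for the symmetry factor of $\tau$. Let $\mathcal H$ be the Butcher--Connes--Kreimer Hopf algebra: the free commutative $\mathbb R$-algebra on the non-empty trees, with unit $\emptyset$ and coproduct $\Delta(\tau)=\sum_c P_c(\tau)\otimes R_c(\tau)$, the sum being over all admissible cuts $c$ of $\tau$ including the empty and the total cut, where $R_c(\tau)$ is the component containing the root and $P_c(\tau)$ is the forest of the remaining components (for the total cut $R_c(\tau)=\emptyset$, $P_c(\tau)=\tau$). A character is an algebra homomorphism $\varphi:\mathcal H\to\mathbb R$; characters form a group $G$ (the Butcher group) under the convolution product $\varphi_1\varphi_2=\mu_{\mathbb R}\circ(\varphi_1\otimes\varphi_2)\circ\Delta$, whose identity is the counit $\varepsilon$. For a character $\zeta$ let $\bar\zeta$ be the character with $\bar\zeta(\tau)=(-1)^{|\tau|}\zeta(\tau)$ for $\tau\in\mathcal T$; $\zeta$ is odd if $\bar\zeta=\zeta^{-1}$. The B-series method $\Psi$ with character $\psi\in G$ assigns to every smooth vector field $f:\mathbb R^N\to\mathbb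 R^N$ ($N\ge 0$) the formal power series in $h$ $$\Psi_{h,f}(y)=B_h(\psi,f)(y)=\sum_{\tau\in\mathcal T}\frac{h^{|\tau|}}{\sigma(\tau)}\,\psi(\tau)\,F(\tau)(y),$$ where $F(\emptyset)(y)=y$ and $F([\tau_1,\dots,\tau_m])(y)=f^{(m)}(y)\bigl(F(\tau_1)(y),\dots,F(\tau_m)(y)\bigr)$. Methods are composed as formal power series in $h$ for each fixed $f$; the adjoint $\Psi^*$ of $\Psi$ is the method with $\Psi^*_{h,f}=(\Psi_{-h,f})^{-1}$, and $\Psi$ is symmetric if $\Psi=\Psi^*$. Let $\Psi$ be a B-series method with character $\psi$. Then: 1. $\Psi$ is symmetric if and only if there exists a B-series method $\Omega$ such that $\Psi=\Omega\circ\Omega^*$. 2. There is exactly one character $\psi^{1/2}\in G$ with $\psi^{1/2}\psi^{1/2}=\psi$. If $\Psi$ is symmetric, then $\psi^{1/2}$ is odd, the B-series method $\Psi^{1/2}$ with character $\psi^{1/2}$ is symmetric, and $\Psi=\Omega\circ\Omega^*$ holds with $\Omega=\Psi^{1/2}$. -/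

import Mathlib

noncomputable section

open scoped ContDiff TensorProduct

namespace BSeries

/-! ### Non-planar rooted trees -/

/-- Non-empty planar rooted trees: a root together with the list of its branches. -/
inductive PTree : Type
  | node : List PTree → PTree

/-- Elementary moves on planar trees: exchange two neighbouring branches of the root, or perform a
move inside one branch. -/
inductive PTree.Step : PTree → PTree → Prop
  | swap (l₁ : List PTree) (a b : PTree) (l₂ : List PTree) :
      PTree.Step (.node (l₁ ++ a :: b :: l₂)) (.node (l₁ ++ b :: a :: l₂))
  | child (l₁ : List PTree) (a b : PTree) (l₂ : List PTree) :
      PTree.Step a b → PTree.Step (.node (l₁ ++ a :: l₂)) (.node (l₁ ++ b :: l₂))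

/-- Non-empty, unlabelled, non-planar rooted trees: planar trees up to reordering of the branches
at every vertex. The empty tree is the unit of the algebra `H` below. -/
def RTree : Type := Quot PTree.Step

/-- The non-planar tree underlying a planar tree. -/
def RTree.mk (t : PTree) : RTree := Quot.mk _ t

theorem RTree.mk_eq_of_map_eq (p : List PTree) {l₁ l₂ : List PTree}
    (h : l₁.map RTree.mk = l₂.map RTree.mk) :
    RTree.mk (.node (p ++ l₁)) = RTree.mk (.node (p ++ l₂)) := by
  have key : ∀ (p l : List PTree) (a b : PTree), RTree.mk a = RTree.mk b →
      RTree.mk (.node (p ++ a :: l)) = RTree.mk (.node (p ++ b :: l)) := by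
    intro p l a b hab
    induction Quot.eqvGen_exact hab with
    | rel x y h => exact Quot.sound (.child _ _ _ _ h)
    | refl => rfl
    | symm x y h ih => exact (ih (Quot.eqvGen_sound h)).symm
    | trans x y z h₁ h₂ ih₁ ih₂ =>
      exact (ih₁ (Quot.eqvGen_sound h₁)).trans (ih₂ (Quot.eqvGen_sound h₂))
  induction l₁ generalizing p l₂ with
  | nil => simp_all
  | cons a l₁ ih =>
    cases l₂ with
    | nil => simp at h
    | cons b l₂ =>
      simp only [List.map_cons, List.cons.injEq] at h
      have := ih (p ++ [a]) h.2
      simp only [List.append_assoc, List.cons_append, List.nil_append] at this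
      exact this.trans (key _ _ _ _ h.1)

theorem RTree.mk_eq_of_perm (p : List PTree) {l₁ l₂ : List PTree} (h : l₁.Perm l₂) :
    RTree.mk (.node (p ++ l₁)) = RTree.mk (.node (p ++ l₂)) := by
  induction h generalizing p with
  | nil => rfl
  | cons x _ ih => simpa using ih (p ++ [x])
  | swap x y l => exact Quot.sound (.swap _ _ _ _)
  | trans _ _ ih₁ ih₂ => exact (ih₁ p).trans (ih₂ p)

/-- A planar representative of a tree. -/
def RTree.rep (τ : RTree) : PTree := Quot.out τ

theorem RTree.mk_rep (τ : RTree) : RTree.mk τ.rep = τ := Quot.out_eq τ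

/-- The tree `[τ₁, …, τₖ]` obtained by joining the roots of `τ₁, …, τₖ` to a new root. -/
def RTree.node (s : Multiset RTree) : RTree := RTree.mk (.node (s.toList.map RTree.rep))

theorem RTree.node_map_mk (ts : List PTree) :
    RTree.node (ts.map RTree.mk : List RTree) = RTree.mk (.node ts) := by
  have h : ((ts.map RTree.mk : List RTree) : Multiset RTree).toList.Perm (ts.map RTree.mk) :=
    Multiset.coe_eq_coe.mp (Multiset.coe_toList _)
  have h' := h.map RTree.rep
  refine (RTree.mk_eq_of_perm [] h').trans (RTree.mk_eq_of_map_eq [] ?_)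
  rw [List.map_map, List.map_map]
  exact List.map_congr_left fun x _ => RTree.mk_rep (RTree.mk x)

mutual
/-- The number of vertices. -/
def PTree.size : PTree → ℕ
  | .node ts => 1 + PTree.sizeList ts
/-- The number of vertices of a list of planar trees. -/
def PTree.sizeList : List PTree → ℕ
  | [] => 0
  | t :: ts => PTree.size t + PTree.sizeList ts
end

theorem PTree.sizeList_append (l₁ l₂ : List PTree) :
    sizeList (l₁ ++ l₂) = sizeList l₁ + sizeList l₂ := by
  induction l₁ with
  | nil => simp [sizeList]
  | cons a l ih => simp [sizeList, ih, add_assoc]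

theorem PTree.size_step {s t : PTree} (h : Step s t) : s.size = t.size := by
  induction h with
  | swap l₁ a b l₂ => simp only [size, sizeList_append, sizeList]; omega
  | child l₁ a b l₂ _ ih => simp only [size, sizeList_append, sizeList, ih]

/-- The number `|τ|` of vertices of a tree. -/
def RTree.size : RTree → ℕ := Quot.lift PTree.size fun _ _ => PTree.size_step

theorem PTree.finite_size_le (n : ℕ) : {t : PTree | t.size ≤ n}.Finite := by
  induction n with
  | zero =>
    convert! Set.finite_empty
    ext ⟨ts⟩
    simp [size]
  | succ n ih =>
    have hlen : ∀ ts : List PTree, ts.length ≤ sizeList ts := by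
      intro ts
      induction ts with
      | nil => simp
      | cons t ts ih => cases t; simp only [List.length_cons, sizeList, size]; omega
    have hmem : ∀ (ts : List PTree), ∀ t ∈ ts, t.size ≤ sizeList ts := by
      intro ts
      induction ts with
      | nil => simp
      | cons t ts ih =>
        intro s hs
        rcases List.mem_cons.mp hs with rfl | hs
        · simp [sizeList]
        · have := ih s hs; simp only [sizeList]; omega
    have : Finite {t : PTree | t.size ≤ n} := ih
    refine ((List.finite_length_le {t : PTree | t.size ≤ n} n).image
      (fun l => PTree.node (l.map Subtype.val))).subset ?_
    rintro ⟨ts⟩ h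
    have h : sizeList ts ≤ n := by simp only [Set.mem_ofPred_eq, size] at h; omega
    refine ⟨ts.attach.map fun t => ⟨t.1, (hmem ts t.1 t.2).trans h⟩, ?_, ?_⟩
    · simpa using (hlen ts).trans h
    · simp [Function.comp_def]

theorem RTree.finite_size_eq (n : ℕ) : {τ : RTree | τ.size = n}.Finite := by
  refine ((PTree.finite_size_le n).image RTree.mk).subset ?_
  rintro ⟨t⟩ h
  exact ⟨t, le_of_eq h, rfl⟩

/-- The finite set of trees with `n` vertices. -/
def treesOfSize (n : ℕ) : Finset RTree := (RTree.finite_size_eq n).toFinset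

open Classical in
/-- `∏ kᵢ!` over the distinct elements of a multiset, with multiplicities `kᵢ`. -/
def multFactorial (s : Multiset RTree) : ℕ := ∏ τ ∈ s.toFinset, (s.count τ).factorial

mutual
/-- The symmetry factor: `σ([τ₁^k₁, …, τₘ^kₘ]) = ∏ kᵢ! σ(τᵢ)^kᵢ` for distinct `τᵢ`. -/
def PTree.sigma : PTree → ℕ
  | .node ts => multFactorial (ts.map RTree.mk : List RTree) * PTree.sigmaList ts
/-- The product of the symmetry factors of a list of planar trees. -/
def PTree.sigmaList : List PTree → ℕ
  | [] => 1
  | t :: ts => PTree.sigma t * PTree.sigmaList ts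
end

theorem PTree.sigmaList_append (l₁ l₂ : List PTree) :
    sigmaList (l₁ ++ l₂) = sigmaList l₁ * sigmaList l₂ := by
  induction l₁ with
  | nil => simp [sigmaList]
  | cons a l ih => simp [sigmaList, ih, mul_assoc]

theorem PTree.map_mk_swap (l₁ : List PTree) (a b : PTree) (l₂ : List PTree) :
    (((l₁ ++ a :: b :: l₂).map RTree.mk : List RTree) : Multiset RTree) =
      ((l₁ ++ b :: a :: l₂).map RTree.mk : List RTree) :=
  Multiset.coe_eq_coe.mpr (((List.Perm.swap b a l₂).append_left l₁).map _)

theorem PTree.map_mk_child (l₁ : List PTree) {a b : PTree} (l₂ : List PTree) (h : Step a b) :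
    (l₁ ++ a :: l₂).map RTree.mk = (l₁ ++ b :: l₂).map RTree.mk := by
  have : RTree.mk a = RTree.mk b := Quot.sound h
  simp [this]

theorem PTree.sigma_step {s t : PTree} (h : Step s t) : s.sigma = t.sigma := by
  induction h with
  | swap l₁ a b l₂ =>
    simp only [sigma, map_mk_swap, sigmaList_append, sigmaList]
    ring
  | child l₁ a b l₂ h ih =>
    simp only [sigma, map_mk_child l₁ l₂ h, sigmaList_append, sigmaList, ih]

/-- The symmetry factor `σ(τ)`. -/
def RTree.sigma : RTree → ℕ := Quot.lift PTree.sigma fun _ _ => PTree.sigma_step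

/-! ### The Butcher–Connes–Kreimer algebra and the Butcher group -/

mutual
/-- The multiset of pairs `(P_c, R_c)` over all admissible cuts `c` of a tree other than the total
cut: `R_c` is the part containing the root, `P_c` the forest of the other components. -/
def PTree.cuts : PTree → Multiset (Multiset RTree × RTree)
  | .node ts => (PTree.childCuts ts).map fun p => (p.1, RTree.node p.2)
/-- The choices for the branches `ts` of a vertex that stays connected to the root: for every
branch either the edge leading to it is cut, and the whole branch is pruned, or this edge is kept
and an admissible cut of the branch is made. The first component collects the pruned trees, the
second one the remaining parts of the branches that are kept. -/
def PTree.childCuts : List PTree → Multiset (Multiset RTree × Multiset RTree)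
  | [] => {(0, 0)}
  | t :: ts => (PTree.childCuts ts).bind fun p =>
      (RTree.mk t ::ₘ p.1, p.2) ::ₘ (PTree.cuts t).map fun q => (q.1 + p.1, q.2 ::ₘ p.2)
end

/-- The choices for a single branch. -/
def PTree.branchCuts (t : PTree) : Multiset (Multiset RTree × Multiset RTree) :=
  ({RTree.mk t}, 0) ::ₘ (PTree.cuts t).map fun q => (q.1, {q.2})

theorem PTree.childCuts_cons (t : PTree) (ts : List PTree) :
    childCuts (t :: ts) =
      (childCuts ts).bind fun p => (branchCuts t).map fun q => q + p := by
  rw [childCuts]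
  refine Multiset.bind_congr fun p _ => ?_
  rw [branchCuts, Multiset.map_cons, Multiset.map_map]
  congr 1
  ext1 <;> simp

theorem PTree.childCuts_swap (l₁ : List PTree) (a b : PTree) (l₂ : List PTree) :
    childCuts (l₁ ++ a :: b :: l₂) = childCuts (l₁ ++ b :: a :: l₂) := by
  induction l₁ with
  | nil =>
    simp only [List.nil_append, childCuts_cons, Multiset.bind_assoc, Multiset.bind_map]
    refine Multiset.bind_congr fun p _ => ?_
    rw [Multiset.bind_map_comm]
    refine Multiset.bind_congr fun q _ => Multiset.map_congr rfl fun r _ => ?_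
    abel
  | cons c l ih => simp only [List.cons_append, childCuts_cons, ih]

theorem PTree.childCuts_child (l₁ : List PTree) {a b : PTree} (l₂ : List PTree)
    (h : RTree.mk a = RTree.mk b) (h' : cuts a = cuts b) :
    childCuts (l₁ ++ a :: l₂) = childCuts (l₁ ++ b :: l₂) := by
  induction l₁ with
  | nil => simp only [List.nil_append, childCuts, h, h']
  | cons c l ih => simp only [List.cons_append, childCuts, ih]

theorem PTree.cuts_step {s t : PTree} (h : Step s t) : s.cuts = t.cuts := by
  induction h with
  | swap l₁ a b l₂ => simp only [cuts, childCuts_swap]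
  | child l₁ a b l₂ h ih =>
    simp only [cuts, childCuts_child l₁ l₂ (Quot.sound h) ih]

/-- The pairs `(P_c(τ), R_c(τ))` over all admissible cuts `c` of `τ` other than the total cut. -/
def RTree.cuts : RTree → Multiset (Multiset RTree × RTree) :=
  Quot.lift PTree.cuts fun _ _ => PTree.cuts_step

/-- The free commutative algebra on the non-empty trees; monomials are forests, `1` is the empty
forest. -/
abbrev H : Type := MvPolynomial RTree ℝ

/-- The forest with the given trees, as an element of `H`. -/
def forest (s : Multiset RTree) : H := (s.map MvPolynomial.X).prod

/-- The coproduct `Δ(τ) = τ ⊗ 1 + ∑_c P_c(τ) ⊗ R_c(τ)`, extended multiplicatively and linearly. -/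
def coproduct : H →ₐ[ℝ] H ⊗[ℝ] H :=
  MvPolynomial.aeval fun τ =>
    (MvPolynomial.X τ : H) ⊗ₜ[ℝ] (1 : H) +
      (τ.cuts.map fun c => forest c.1 ⊗ₜ[ℝ] (MvPolynomial.X c.2 : H)).sum

/-- The counit: it vanishes on all non-empty trees. -/
def counit : H →ₐ[ℝ] ℝ := MvPolynomial.aeval fun _ => 0

/-- The elements of the Butcher group: characters of `H`. -/
abbrev Character : Type := H →ₐ[ℝ] ℝ

/-- The convolution product `φ₁ * φ₂ = μ ∘ (φ₁ ⊗ φ₂) ∘ Δ`. -/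
def conv (φ₁ φ₂ : Character) : Character :=
  (Algebra.TensorProduct.lmul' ℝ).comp ((Algebra.TensorProduct.map φ₁ φ₂).comp coproduct)

/-- The canonical involution `τ ↦ (-1)^|τ| τ` of `H`. -/
def involution : H →ₐ[ℝ] H :=
  MvPolynomial.aeval fun τ => (-1 : ℝ) ^ τ.size • (MvPolynomial.X τ : H)

/-- The involution induced on characters. -/
def bar (ζ : Character) : Character := ζ.comp involution

/-- A character `ζ` is odd if `bar ζ` is its inverse in the Butcher group. -/
def IsOdd (ζ : Character) : Prop := conv ζ (bar ζ) = counit ∧ conv (bar ζ) ζ = counit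

/-! ### Formal power series in the step size -/

section Formal

variable {E : Type*} [NormedAddCommGroup E] [NormedSpace ℝ E]

/-- Smoothness of the evaluation of a smooth family of multilinear maps on smooth families of
vectors. -/
theorem contDiff_multilinear_apply {V W : Type*} [NormedAddCommGroup V] [NormedSpace ℝ V]
    [NormedAddCommGroup W] [NormedSpace ℝ W] (n : ℕ) {M : E → V [×n]→L[ℝ] W}
    {v : Fin n → E → V} (hM : ContDiff ℝ ∞ M) (hv : ∀ i, ContDiff ℝ ∞ (v i)) :
    ContDiff ℝ ∞ fun y => M y fun i => v i y := by
  induction n with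
  | zero =>
    have : (fun y => M y fun i => v i y) =
        fun y => (continuousMultilinearCurryFin0 ℝ V W) (M y) := by
      funext y
      rw [continuousMultilinearCurryFin0_apply]
      congr 1
      exact Subsingleton.elim _ _
    rw [this]
    exact (continuousMultilinearCurryFin0 ℝ V W).contDiff.comp hM
  | succ n ih =>
    let I : (V [×(n + 1)]→L[ℝ] W) ≃ₗᵢ[ℝ] (V →L[ℝ] V [×n]→L[ℝ] W) :=
      continuousMultilinearCurryLeftEquiv ℝ (fun _ : Fin (n + 1) => V) W
    have hI : ContDiff ℝ ∞ fun L => I L := by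
      have : IsBoundedLinearMap ℝ fun L => I L :=
        IsLinearMap.with_bound ⟨fun x y => I.map_add x y, fun c x => I.map_smul c x⟩ 1
          fun x => by rw [one_mul]; exact (I.norm_map x).le
      exact this.contDiff
    have h1 : ContDiff ℝ ∞ fun y => I (M y) := hI.comp hM
    have h2 := ih (h1.clm_apply (hv 0)) (fun i => hv i.succ)
    convert h2 using 2 with y
    simp only [I, continuousMultilinearCurryLeftEquiv_apply]
    congr 1
    funext i
    refine Fin.cases ?_ (fun j => ?_) i <;> simp

/-- A formal one-step map `y ↦ y + ∑_{n ≥ 1} hⁿ cₙ(y)`: a formal power series in the step size `h`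
whose coefficients are smooth maps and which is the identity for `h = 0`. -/
@[ext]
structure FormalMap (E : Type*) [NormedAddCommGroup E] [NormedSpace ℝ E] where
  coeff : ℕ → E → E
  coeff_zero : coeff 0 = id
  smooth : ∀ n, ContDiff ℝ ∞ (coeff n)

namespace FormalMap

/-- The truncation `∑_{n ≤ k} hⁿ cₙ(y)`. -/
def trunc (Φ : FormalMap E) (k : ℕ) (h : ℝ) (y : E) : E :=
  ∑ n ∈ Finset.range (k + 1), h ^ n • Φ.coeff n y

theorem trunc_smooth (Φ : FormalMap E) (k : ℕ) :
    ContDiff ℝ ∞ fun p : ℝ × E => Φ.trunc k p.1 p.2 := by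
  unfold trunc
  exact ContDiff.sum fun n _ => (contDiff_fst.pow n).smul ((Φ.smooth n).comp contDiff_snd)

theorem iteratedDeriv_smooth (k : ℕ) {g : ℝ × E → E} (hg : ContDiff ℝ ∞ g) :
    ContDiff ℝ ∞ fun p : ℝ × E => iteratedDeriv k (fun h => g (h, p.2)) p.1 := by
  induction k with
  | zero => simpa [iteratedDeriv_zero] using hg
  | succ k ih =>
    have h1 : ContDiff ℝ ∞ (fderiv ℝ fun p : ℝ × E =>
        iteratedDeriv k (fun h => g (h, p.2)) p.1) := ih.fderiv_right (by simp)
    have h2 := h1.clm_apply (contDiff_const (c := ((1 : ℝ), (0 : E))))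
    convert h2 using 2 with p
    rw [iteratedDeriv_succ]
    have hd : HasDerivAt (fun h : ℝ => (h, p.2)) ((1 : ℝ), (0 : E)) p.1 :=
      (hasDerivAt_id p.1).prodMk (hasDerivAt_const p.1 p.2)
    have hF : HasFDerivAt (fun p : ℝ × E => iteratedDeriv k (fun h => g (h, p.2)) p.1)
        (fderiv ℝ (fun p : ℝ × E => iteratedDeriv k (fun h => g (h, p.2)) p.1) (p.1, p.2))
        (p.1, p.2) := (ih.differentiable (by simp) _).hasFDerivAt
    exact (hF.comp_hasDerivAt p.1 hd).deriv

/-- The identity map. -/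
def one : FormalMap E where
  coeff n := if n = 0 then id else 0
  coeff_zero := by simp
  smooth n := by
    split_ifs
    · exact contDiff_id
    · exact contDiff_const

/-- The composition `Ψ_h ∘ Φ_h` of formal maps: the coefficient of `h^k` is the `k`-th Taylor
coefficient at `h = 0` of `h ↦ Ψ_h(Φ_h(y))`, in which the terms of `Ψ` and `Φ` of order larger
than `k` play no role. -/
def comp (Ψ Φ : FormalMap E) : FormalMap E where
  coeff k y := ((k.factorial : ℝ)⁻¹) •
    iteratedDeriv k (fun h : ℝ => Ψ.trunc k h (Φ.trunc k h y)) 0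
  coeff_zero := by
    funext y
    simp [trunc, Ψ.coeff_zero, Φ.coeff_zero]
  smooth k := by
    have h1 : ContDiff ℝ ∞ fun p : ℝ × E => Ψ.trunc k p.1 (Φ.trunc k p.1 p.2) :=
      (Ψ.trunc_smooth k).comp (contDiff_fst.prodMk (Φ.trunc_smooth k))
    have h2 := (iteratedDeriv_smooth k h1).comp
      ((contDiff_const (c := (0 : ℝ))).prodMk (contDiff_id (E := E)))
    exact contDiff_const.smul h2

/-- The formal map `Φ_{-h}`. -/
def reverse (Φ : FormalMap E) : FormalMap E where
  coeff n y := (-1 : ℝ) ^ n • Φ.coeff n y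
  coeff_zero := by funext y; simp [Φ.coeff_zero]
  smooth n := contDiff_const.smul (Φ.smooth n)

/-- `X` is the adjoint of `Φ`, that is, `X_h` is the inverse of `Φ_{-h}`. -/
def IsAdjoint (Φ X : FormalMap E) : Prop :=
  X.comp Φ.reverse = one ∧ Φ.reverse.comp X = one

end FormalMap

/-! ### Elementary differentials -/

/-- Iterated directional derivatives. -/
def dirDeriv (f : E → E) : List E → E → E
  | [] => f
  | v :: l => fun y => fderiv ℝ (dirDeriv f l) y v

theorem dirDeriv_smooth {f : E → E} (hf : ContDiff ℝ ∞ f) (l : List E) :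
    ContDiff ℝ ∞ (dirDeriv f l) := by
  induction l with
  | nil => exact hf
  | cons v l ih => exact (ih.fderiv_right (by simp)).clm_apply contDiff_const

theorem dirDeriv_perm {f : E → E} (hf : ContDiff ℝ ∞ f) {l₁ l₂ : List E} (h : l₁.Perm l₂) :
    dirDeriv f l₁ = dirDeriv f l₂ := by
  induction h with
  | nil => rfl
  | cons x _ ih => simp only [dirDeriv, ih]
  | swap x y l =>
    funext z
    have hs := dirDeriv_smooth hf l
    have h1 : ∀ v, fderiv ℝ (fun y => fderiv ℝ (dirDeriv f l) y v) z =
        (fderiv ℝ (fderiv ℝ (dirDeriv f l)) z).flip v := by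
      intro v
      have hd : DifferentiableAt ℝ (fderiv ℝ (dirDeriv f l)) z :=
        (hs.fderiv_right (m := ∞) (by simp)).differentiable (by simp) z
      ext w
      rw [fderiv_clm_apply hd (differentiableAt_const v)]
      simp
    simp only [dirDeriv, h1, ContinuousLinearMap.flip_apply]
    exact (hs.contDiffAt.isSymmSndFDerivAt (by simpa using ENat.LEInfty.out)).eq y x
  | trans _ _ ih₁ ih₂ => exact ih₁.trans ih₂

/-- The value `f⁽ᵐ⁾(y)(v₁, …, vₘ)` of the `m`-th derivative of `f`. -/
def derivApply (f : E → E) (l : List E) (y : E) : E := iteratedFDeriv ℝ l.length f y l.get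

theorem derivApply_eq_dirDeriv {f : E → E} (hf : ContDiff ℝ ∞ f) (l : List E) :
    derivApply f l = dirDeriv f l := by
  induction l with
  | nil => funext y; simp [derivApply, dirDeriv]
  | cons v l ih =>
    funext y
    have hd : DifferentiableAt ℝ (iteratedFDeriv ℝ l.length f) y :=
      (hf.iteratedFDeriv_right (m := ∞) (by exact_mod_cast le_top)).differentiable (by simp) y
    have h1 : fderiv ℝ (derivApply f l) y v =
        fderiv ℝ (iteratedFDeriv ℝ l.length f) y v l.get := by
      have := hd.hasFDerivAt.continuousMultilinear_apply_const l.get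
      exact congrArg (fun L => L v) this.fderiv
    simp only [dirDeriv, ← ih, h1]
    simp only [derivApply, List.length_cons, iteratedFDeriv_succ_apply_left]
    rfl

mutual
/-- The elementary differential of a planar tree:
`F([τ₁, …, τₘ])(y) = f⁽ᵐ⁾(y)(F(τ₁)(y), …, F(τₘ)(y))`. -/
def PTree.elem (f : E → E) : PTree → E → E
  | .node ts => fun y => derivApply f (PTree.elemList f ts y) y
/-- The list of the elementary differentials of a list of planar trees. -/
def PTree.elemList (f : E → E) : List PTree → E → List E
  | [] => fun _ => []
  | t :: ts => fun y => PTree.elem f t y :: PTree.elemList f ts y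
end

theorem PTree.elemList_eq_map (f : E → E) (ts : List PTree) (y : E) :
    elemList f ts y = ts.map fun t => elem f t y := by
  induction ts with
  | nil => simp [elemList]
  | cons t ts ih => simp [elemList, ih]

theorem PTree.elem_step {f : E → E} (hf : ContDiff ℝ ∞ f) {s t : PTree} (h : Step s t) :
    elem f s = elem f t := by
  induction h with
  | swap l₁ a b l₂ =>
    funext y
    simp only [elem, elemList_eq_map, derivApply_eq_dirDeriv hf]
    exact congrFun (dirDeriv_perm hf (((List.Perm.swap b a l₂).append_left l₁).map _)) y
  | child l₁ a b l₂ _ ih =>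
    funext y
    simp only [elem, elemList_eq_map, List.map_append, List.map_cons, ih]

mutual
theorem PTree.elem_smooth {f : E → E} (hf : ContDiff ℝ ∞ f) :
    ∀ t : PTree, ContDiff ℝ ∞ (elem f t)
  | .node ts => by
    have h := contDiff_multilinear_apply ts.length
      (M := iteratedFDeriv ℝ ts.length f) (v := fun i => elem f (ts.get i))
      (hf.iteratedFDeriv_right (m := ∞) (by exact_mod_cast le_top))
      (fun i => PTree.elem_smooth_list hf ts _ (List.get_mem ts i))
    convert h using 2 with y
    simp only [elem, derivApply]
    have key : ∀ (n : ℕ) (hn : n = ts.length) (w : Fin n → E),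
        (∀ i, w i = elem f (ts.get (Fin.cast hn i)) y) →
        iteratedFDeriv ℝ n f y w =
          iteratedFDeriv ℝ ts.length f y fun i => elem f (ts.get i) y := by
      intro n hn w hw
      subst hn
      congr 1
      funext i
      exact hw i
    exact key _ (by simp [elemList_eq_map]) _ fun i => by simp [elemList_eq_map]
theorem PTree.elem_smooth_list {f : E → E} (hf : ContDiff ℝ ∞ f) :
    ∀ (ts : List PTree), ∀ t ∈ ts, ContDiff ℝ ∞ (elem f t)
  | [] => by simp
  | s :: ts => fun t ht => by
    rcases List.mem_cons.mp ht with h | h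
    · rw [h]
      exact PTree.elem_smooth hf s
    · exact PTree.elem_smooth_list hf ts t h
end

end Formal

/-! ### B-series methods -/

/-- Smooth vector fields on `ℝᴺ`. -/
structure VectorField (N : ℕ) where
  toFun : EuclideanSpace ℝ (Fin N) → EuclideanSpace ℝ (Fin N)
  smooth : ContDiff ℝ ∞ toFun

/-- The elementary differential `F(τ)` of a non-empty tree with respect to `f`. -/
def elemDiff {N : ℕ} (f : VectorField N) :
    RTree → EuclideanSpace ℝ (Fin N) → EuclideanSpace ℝ (Fin N) :=
  Quot.lift (PTree.elem f.toFun) fun _ _ => PTree.elem_step f.smooth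

theorem elemDiff_smooth {N : ℕ} (f : VectorField N) (τ : RTree) : ContDiff ℝ ∞ (elemDiff f τ) := by
  obtain ⟨t⟩ := τ
  exact PTree.elem_smooth f.smooth t

/-- A formal one-step method assigns to every smooth vector field `f` on some `ℝᴺ` a formal map
`Ψ_{h,f}` of `ℝᴺ`. -/
def Method : Type := ∀ N : ℕ, VectorField N → FormalMap (EuclideanSpace ℝ (Fin N))

/-- The composition `Ψ ∘ Φ` of methods. -/
def Method.comp (Ψ Φ : Method) : Method := fun N f => (Ψ N f).comp (Φ N f)

/-- The method `X` is the adjoint method of `Φ`, that is, `X_{h,f} = (Φ_{-h,f})⁻¹` for all `f`. -/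
def Method.IsAdjoint (Φ X : Method) : Prop := ∀ N f, (Φ N f).IsAdjoint (X N f)

/-- A method is symmetric if it is its own adjoint. -/
def Method.IsSymmetric (Φ : Method) : Prop := Φ.IsAdjoint Φ

/-- The B-series method with character `φ`,
`B_h(φ, f)(y) = y + ∑_τ h^|τ| φ(τ) / σ(τ) F(τ)(y)`, the sum being over the non-empty trees. -/
def bSeries (φ : Character) : Method := fun N f =>
  { coeff := fun n y =>
      if n = 0 then y
      else ∑ τ ∈ treesOfSize n, (φ (MvPolynomial.X τ) / (τ.sigma : ℝ)) • elemDiff f τ y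
    coeff_zero := by funext y; simp
    smooth := fun n => by
      by_cases hn : n = 0
      · simp only [hn, if_true]
        exact contDiff_id
      · simp only [hn, if_false]
        exact ContDiff.sum fun τ _ => (elemDiff_smooth f τ).const_smul _ }

end BSeries

end

/-!
A symmetric method is its own adjoint, and the B-series method with character `φ` has as its adjoint
the one with character `(bar φ)⁻¹`. The map `star φ = (bar φ)⁻¹` is an anti-involution of the
Butcher group, so the characters of symmetric methods are the self-adjoint ones. Every `star ω * ω`
is self-adjoint. Conversely `χ * χ = ψ` can be solved uniquely by recursion on the number of
vertices, since `χ(τ)` enters its value at `τ` only through the term `2 χ(τ)`; if `ψ` is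
self-adjoint, then `star χ` is another square root of `ψ`, hence equal to `χ`.

This rests on the fact that `φ ↦ bSeries φ` is injective and turns convolution into composition.
Both parts hold for the linear span of functions on trees obtained by repeated grafting
`b ↦ ([τ₁, …, τₘ] ↦ b(τ₁) ⋯ b(τₘ))`, which contains all functions up to any given order because
distinct forests are linearly independent. For composition, the B-series of a graft is the vector
field along the B-series, by Taylor expansion, and this is compatible with cutting trees. For
injectivity, grafting is realised by adding an exponential coordinate to the vector field.
-/

noncomputable section

open scoped ContDiff

namespace BSeries

open Asymptotics Filter Topology

theorem prod_map_pow_eq_pow_sum {ι M : Type*} [CommMonoid M] (s : Multiset ι) (x : M)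
    (n : ι → ℕ) : (s.map fun i => x ^ n i).prod = x ^ (s.map n).sum := by
  induction s using Multiset.induction with
  | empty => simp
  | cons i s ih => simp [pow_add, ih]

/-! ### The structure of the set of trees -/

/-- The branches of the root of a tree. -/
def RTree.children : RTree → Multiset RTree :=
  Quot.lift (fun | .node ts => (ts.map RTree.mk : List RTree)) fun _ _ h => by
    cases h with
    | swap l₁ a b l₂ => exact PTree.map_mk_swap l₁ a b l₂
    | child l₁ a b l₂ h => exact congrArg _ (PTree.map_mk_child l₁ l₂ h)

theorem RTree.children_mk (ts : List PTree) :
    (RTree.mk (.node ts)).children = (ts.map RTree.mk : List RTree) := rfl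

theorem RTree.exists_list_map_mk (s : Multiset RTree) :
    ∃ ts : List PTree, s = (ts.map RTree.mk : List RTree) := by
  induction s using Quot.inductionOn with
  | h l => exact ⟨l.map RTree.rep, by simp [Function.comp_def, RTree.mk_rep]⟩

@[simp] theorem RTree.children_node (s : Multiset RTree) : (RTree.node s).children = s := by
  obtain ⟨ts, rfl⟩ := RTree.exists_list_map_mk s
  rw [RTree.node_map_mk, RTree.children_mk]

@[simp] theorem RTree.node_children (τ : RTree) : RTree.node τ.children = τ := by
  obtain ⟨⟨ts⟩⟩ := τ
  exact RTree.node_map_mk ts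

theorem RTree.node_injective : Function.Injective RTree.node :=
  Function.LeftInverse.injective RTree.children_node

theorem RTree.children_injective : Function.Injective RTree.children :=
  Function.LeftInverse.injective RTree.node_children

theorem PTree.sizeList_eq_sum (ts : List PTree) :
    sizeList ts = (ts.map fun t => (RTree.mk t).size).sum := by
  induction ts with
  | nil => simp [sizeList]
  | cons t ts ih => simp only [sizeList, ih, List.map_cons, List.sum_cons]; rfl

theorem PTree.sigmaList_eq_prod (ts : List PTree) :
    sigmaList ts = (ts.map fun t => (RTree.mk t).sigma).prod := by
  induction ts with
  | nil => simp [sigmaList]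
  | cons t ts ih => simp only [sigmaList, ih, List.map_cons, List.prod_cons]; rfl

theorem RTree.size_node (s : Multiset RTree) :
    (RTree.node s).size = 1 + (s.map RTree.size).sum := by
  obtain ⟨ts, rfl⟩ := RTree.exists_list_map_mk s
  rw [RTree.node_map_mk]
  change PTree.size (.node ts) = _
  simp [PTree.size, PTree.sizeList_eq_sum, Function.comp_def]

theorem RTree.sigma_node (s : Multiset RTree) :
    (RTree.node s).sigma = multFactorial s * (s.map RTree.sigma).prod := by
  obtain ⟨ts, rfl⟩ := RTree.exists_list_map_mk s
  rw [RTree.node_map_mk]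
  change PTree.sigma (.node ts) = _
  simp [PTree.sigma, PTree.sigmaList_eq_prod, Function.comp_def]

theorem RTree.size_pos (τ : RTree) : 0 < τ.size := by
  rw [← τ.node_children, RTree.size_node]; omega

theorem RTree.size_le_sum_of_mem {s : Multiset RTree} {τ : RTree} (h : τ ∈ s) :
    τ.size ≤ (s.map RTree.size).sum :=
  Multiset.single_le_sum (fun _ _ => Nat.zero_le _) _ (Multiset.mem_map_of_mem _ h)

theorem RTree.size_lt_of_mem_children {τ θ : RTree} (h : θ ∈ τ.children) : θ.size < τ.size := by
  have := RTree.size_le_sum_of_mem h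
  rw [← τ.node_children, RTree.size_node]; omega

theorem RTree.card_children_lt_size (τ : RTree) : τ.children.card < τ.size := by
  have : τ.children.card • 1 ≤ (τ.children.map RTree.size).sum := by
    rw [← Multiset.card_map RTree.size]
    refine Multiset.card_nsmul_le_sum fun n hn => ?_
    obtain ⟨θ, -, rfl⟩ := Multiset.mem_map.mp hn
    exact θ.size_pos
  rw [smul_eq_mul, mul_one] at this
  conv_rhs => rw [← τ.node_children, RTree.size_node]
  omega

theorem RTree.wellFounded_size_lt : WellFounded fun θ τ : RTree => θ.size < τ.size :=
  (measure RTree.size).wf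

theorem multFactorial_ne_zero (s : Multiset RTree) : multFactorial s ≠ 0 :=
  Finset.prod_ne_zero_iff.mpr fun _ _ => Nat.factorial_ne_zero _

theorem RTree.sigma_ne_zero (τ : RTree) : τ.sigma ≠ 0 := by
  induction τ using RTree.wellFounded_size_lt.induction with
  | _ τ ih =>
    rw [← τ.node_children, RTree.sigma_node]
    refine mul_ne_zero (multFactorial_ne_zero _) (Multiset.prod_ne_zero fun h0 => ?_)
    obtain ⟨θ, hθ, h0⟩ := Multiset.mem_map.mp h0
    exact ih θ (RTree.size_lt_of_mem_children hθ) h0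

open Classical in
/-- The finite set of trees with at most `k` vertices. -/
def treesUpTo (k : ℕ) : Finset RTree := (Finset.range (k + 1)).biUnion treesOfSize

@[simp] theorem mem_treesOfSize {n : ℕ} {τ : RTree} : τ ∈ treesOfSize n ↔ τ.size = n := by
  simp [treesOfSize]

@[simp] theorem mem_treesUpTo {k : ℕ} {τ : RTree} : τ ∈ treesUpTo k ↔ τ.size ≤ k := by
  simp [treesUpTo]

theorem treesOfSize_zero : treesOfSize 0 = ∅ := by
  ext τ
  simpa using τ.size_pos.ne'

theorem sum_treesUpTo {M : Type*} [AddCommMonoid M] (k : ℕ) (g : RTree → M) :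
    ∑ τ ∈ treesUpTo k, g τ = ∑ n ∈ Finset.range (k + 1), ∑ τ ∈ treesOfSize n, g τ := by
  classical
  refine Finset.sum_biUnion fun m _ n _ hmn => Finset.disjoint_left.mpr fun τ hm hn => hmn ?_
  exact (mem_treesOfSize.mp hm).symm.trans (mem_treesOfSize.mp hn)

/-! ### Admissible cuts -/

mutual
theorem PTree.size_cuts : ∀ (t : PTree), ∀ c ∈ cuts t,
    (c.1.map RTree.size).sum + c.2.size = t.size
  | .node ts => by
    intro c hc
    rw [cuts, Multiset.mem_map] at hc
    obtain ⟨p, hp, rfl⟩ := hc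
    have := PTree.size_childCuts ts p hp
    simp only [RTree.size_node, size]
    omega
theorem PTree.size_childCuts : ∀ (ts : List PTree), ∀ p ∈ childCuts ts,
    (p.1.map RTree.size).sum + (p.2.map RTree.size).sum = sizeList ts
  | [] => by simp [childCuts, sizeList]
  | t :: ts => by
    intro c hc
    rw [childCuts, Multiset.mem_bind] at hc
    obtain ⟨p, hp, hc⟩ := hc
    have h1 := PTree.size_childCuts ts p hp
    rw [Multiset.mem_cons, Multiset.mem_map] at hc
    rcases hc with rfl | ⟨q, hq, rfl⟩
    · have : (RTree.mk t).size = t.size := rfl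
      simp only [Multiset.map_cons, Multiset.sum_cons, sizeList]
      omega
    · have := PTree.size_cuts t q hq
      simp only [Multiset.map_cons, Multiset.sum_cons, Multiset.map_add, Multiset.sum_add, sizeList]
      omega
end

theorem RTree.size_cuts {τ : RTree} {c : Multiset RTree × RTree} (hc : c ∈ τ.cuts) :
    (c.1.map RTree.size).sum + c.2.size = τ.size := by
  obtain ⟨t⟩ := τ
  exact PTree.size_cuts t c hc

mutual
theorem PTree.exists_cuts_eq_cons : ∀ t : PTree, ∃ C : Multiset (Multiset RTree × RTree),
    cuts t = (0, RTree.mk t) ::ₘ C ∧ ∀ c ∈ C, c.1 ≠ 0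
  | .node ts => by
    obtain ⟨C, hC, h0⟩ := PTree.exists_childCuts_eq_cons ts
    refine ⟨C.map fun p => (p.1, RTree.node p.2), ?_, ?_⟩
    · rw [cuts, hC, Multiset.map_cons, RTree.node_map_mk]
    · intro c hc
      obtain ⟨p, hp, rfl⟩ := Multiset.mem_map.mp hc
      exact h0 p hp
theorem PTree.exists_childCuts_eq_cons : ∀ ts : List PTree,
    ∃ C : Multiset (Multiset RTree × Multiset RTree),
    childCuts ts = ((0 : Multiset RTree), ((ts.map RTree.mk : List RTree) : Multiset RTree)) ::ₘ C ∧
      ∀ c ∈ C, c.1 ≠ 0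
  | [] => ⟨0, by simp [childCuts], by simp⟩
  | t :: ts => by
    obtain ⟨C, hC, h0⟩ := PTree.exists_childCuts_eq_cons ts
    obtain ⟨C', hC', h0'⟩ := PTree.exists_cuts_eq_cons t
    rw [childCuts, hC, Multiset.cons_bind, hC', Multiset.map_cons, Multiset.cons_swap]
    simp only [Multiset.cons_add, add_zero, Multiset.cons_coe, List.map_cons]
    refine ⟨_, rfl, ?_⟩
    intro c hc
    simp only [Multiset.mem_cons, Multiset.mem_add, Multiset.mem_map, Multiset.mem_bind] at hc
    rcases hc with rfl | ⟨q, hq, rfl⟩ | ⟨p, hp, rfl | ⟨q, _, rfl⟩⟩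
    · simp
    · exact h0' q hq
    · simp
    · simp [h0 p hp]
end

open Classical in
/-- The admissible cuts that are neither empty nor total: those that prune something, as `cuts`
does not list the total cut. -/
def RTree.properCuts (τ : RTree) : Multiset (Multiset RTree × RTree) :=
  τ.cuts.filter fun c => c.1 ≠ 0

theorem RTree.mem_properCuts {τ : RTree} {c : Multiset RTree × RTree} :
    c ∈ τ.properCuts ↔ c ∈ τ.cuts ∧ c.1 ≠ 0 := by
  classical
  exact Multiset.mem_filter

theorem RTree.cuts_eq_cons (τ : RTree) : τ.cuts = (0, τ) ::ₘ τ.properCuts := by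
  classical
  obtain ⟨t⟩ := τ
  obtain ⟨C, hC, h0⟩ := PTree.exists_cuts_eq_cons t
  have hcuts : RTree.cuts (RTree.mk t) = (0, RTree.mk t) ::ₘ C := hC
  change RTree.cuts (RTree.mk t) = (0, RTree.mk t) ::ₘ RTree.properCuts (RTree.mk t)
  rw [RTree.properCuts, hcuts, Multiset.filter_cons_of_neg _ (by simp),
    Multiset.filter_eq_self.mpr h0]

theorem RTree.size_snd_le {τ : RTree} {c : Multiset RTree × RTree} (hc : c ∈ τ.cuts) :
    c.2.size ≤ τ.size := by
  have := RTree.size_cuts hc; omega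

theorem RTree.size_lt_of_mem_fst {τ θ : RTree} {c : Multiset RTree × RTree} (hc : c ∈ τ.cuts)
    (hθ : θ ∈ c.1) : θ.size < τ.size := by
  have := RTree.size_cuts hc
  have := RTree.size_pos c.2
  have := RTree.size_le_sum_of_mem hθ
  omega

theorem RTree.size_snd_lt {τ : RTree} {c : Multiset RTree × RTree} (hc : c ∈ τ.properCuts) :
    c.2.size < τ.size := by
  obtain ⟨hcuts, hne⟩ := RTree.mem_properCuts.mp hc
  have := RTree.size_cuts hcuts
  obtain ⟨θ, hθ⟩ := Multiset.exists_mem_of_ne_zero hne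
  have := RTree.size_le_sum_of_mem hθ
  have := θ.size_pos
  omega

/-! ### Grafting and sums over cuts -/

section Graft

variable {R : Type*} [CommSemiring R]

/-- The multiplicative extension `[τ₁, …, τₘ] ↦ b(τ₁) ⋯ b(τₘ)` of a function on trees. -/
def graft (b : RTree → R) (τ : RTree) : R := (τ.children.map b).prod

@[simp] theorem graft_node (b : RTree → R) (s : Multiset RTree) :
    graft b (RTree.node s) = (s.map b).prod := by simp [graft]

theorem graft_congr {b b' : RTree → R} {τ : RTree}
    (h : ∀ θ : RTree, θ.size < τ.size → b θ = b' θ) : graft b τ = graft b' τ :=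
  congrArg _ (Multiset.map_congr rfl fun θ hθ => h θ (RTree.size_lt_of_mem_children hθ))

/-- The function `τ ↦ ∑_c a(P_c(τ)) b(R_c(τ))`, the sum being over all cuts but the total one and
`a` being extended multiplicatively to forests. -/
def cutSum (a : RTree → R) : (RTree → R) →ₗ[R] RTree → R where
  toFun b τ := (τ.cuts.map fun c => (c.1.map a).prod * b c.2).sum
  map_add' b b' := by
    funext τ
    simp [mul_add, Multiset.sum_map_add]
  map_smul' r b := by
    funext τ
    simp [mul_left_comm, Multiset.sum_map_mul_left]

theorem cutSum_apply (a b : RTree → R) (τ : RTree) :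
    cutSum a b τ = (τ.cuts.map fun c => (c.1.map a).prod * b c.2).sum := rfl

theorem cutSum_congr (a : RTree → R) {b b' : RTree → R} {τ : RTree}
    (h : ∀ θ : RTree, θ.size ≤ τ.size → b θ = b' θ) : cutSum a b τ = cutSum a b' τ :=
  congrArg _ (Multiset.map_congr rfl fun _ hc => by rw [h _ (RTree.size_snd_le hc)])

theorem sum_childCuts (a b : RTree → R) (ts : List PTree) :
    ((PTree.childCuts ts).map fun p => (p.1.map a).prod * (p.2.map b).prod).sum =
      (ts.map fun t => (a + cutSum a b) (RTree.mk t)).prod := by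
  induction ts with
  | nil => simp [PTree.childCuts]
  | cons t ts ih =>
    rw [List.map_cons, List.prod_cons, ← ih, PTree.childCuts, Multiset.map_bind,
      Multiset.sum_bind, ← Multiset.sum_map_mul_left]
    refine congrArg _ (Multiset.map_congr rfl fun p _ => ?_)
    have hcuts : (RTree.mk t).cuts = t.cuts := rfl
    rw [Multiset.map_cons, Multiset.sum_cons, Multiset.map_map, Pi.add_apply, add_mul,
      cutSum_apply, ← Multiset.sum_map_mul_right, hcuts]
    congr 1
    · simp only [Multiset.map_cons, Multiset.prod_cons, mul_assoc]
    · refine congrArg _ (Multiset.map_congr rfl fun q _ => ?_)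
      simp only [Function.comp_apply, Multiset.map_add, Multiset.prod_add, Multiset.map_cons,
        Multiset.prod_cons]
      ring

/-- Cutting a grafted tree means, independently for every branch, to prune it entirely or to cut
inside it. -/
theorem cutSum_graft (a b : RTree → R) : cutSum a (graft b) = graft (a + cutSum a b) := by
  funext τ
  obtain ⟨⟨ts⟩⟩ := τ
  calc cutSum a (graft b) (RTree.mk (.node ts))
      = ((PTree.childCuts ts).map fun p => (p.1.map a).prod * (p.2.map b).prod).sum := by
        have hcuts : (RTree.mk (.node ts)).cuts =
            (PTree.childCuts ts).map fun p => (p.1, RTree.node p.2) := by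
          rw [← PTree.cuts]
          rfl
        simp [cutSum_apply, hcuts]
    _ = (ts.map fun t => (a + cutSum a b) (RTree.mk t)).prod := sum_childCuts a b ts
    _ = graft (a + cutSum a b) (RTree.mk (.node ts)) := by
        rw [graft, RTree.children_mk, Multiset.map_coe, Multiset.prod_coe, List.map_map]
        rfl

/-- The part of `cutSum` coming from the proper cuts, which involves only smaller trees. -/
def properCutSum (a b : RTree → R) (τ : RTree) : R :=
  (τ.properCuts.map fun c => (c.1.map a).prod * b c.2).sum

theorem cutSum_eq_add_properCutSum (a b : RTree → R) (τ : RTree) :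
    cutSum a b τ = b τ + properCutSum a b τ := by
  simp [cutSum_apply, RTree.cuts_eq_cons, properCutSum]

theorem properCutSum_congr {a a' b b' : RTree → R} {τ : RTree}
    (ha : ∀ θ : RTree, θ.size < τ.size → a θ = a' θ)
    (hb : ∀ θ : RTree, θ.size < τ.size → b θ = b' θ) :
    properCutSum a b τ = properCutSum a' b' τ := by
  refine congrArg _ (Multiset.map_congr rfl fun c hc => ?_)
  have hcuts := (RTree.mem_properCuts.mp hc).1
  rw [hb _ (RTree.size_snd_lt hc),
    Multiset.map_congr rfl fun θ hθ => ha θ (RTree.size_lt_of_mem_fst hcuts hθ)]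

end Graft

/-! ### Characters as functions on trees -/

/-- A character is the same as a function on the non-empty trees, namely the function of its values
there. -/
def values : Character ≃ (RTree → ℝ) where
  toFun φ τ := φ (MvPolynomial.X τ)
  invFun a := MvPolynomial.aeval a
  left_inv φ := MvPolynomial.algHom_ext fun τ => by simp
  right_inv a := funext fun τ => by simp

theorem values_apply (φ : Character) (τ : RTree) : values φ τ = φ (MvPolynomial.X τ) := rfl

theorem map_forest (φ : Character) (s : Multiset RTree) :
    φ (forest s) = (s.map (values φ)).prod := by
  rw [forest, map_multiset_prod, Multiset.map_map]
  rfl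

theorem values_counit : values counit = 0 :=
  funext fun τ => by simp [values_apply, counit]

theorem values_conv (φ ψ : Character) :
    values (conv φ ψ) = values φ + cutSum (values φ) (values ψ) := by
  funext τ
  simp only [values_apply, conv, coproduct, AlgHom.comp_apply, MvPolynomial.aeval_X, map_add,
    map_multiset_sum, Multiset.map_map, Function.comp_def, Algebra.TensorProduct.map_tmul,
    Algebra.TensorProduct.lmul'_apply_tmul, map_one, mul_one, map_forest, cutSum_apply,
    Pi.add_apply]

theorem values_bar (φ : Character) (τ : RTree) :
    values (bar φ) τ = (-1) ^ τ.size * values φ τ := by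
  simp [values_apply, bar, involution]

theorem bar_bar (φ : Character) : bar (bar φ) = φ :=
  values.injective <| funext fun τ => by
    rw [values_bar, values_bar, ← mul_assoc, ← mul_pow, neg_one_mul, neg_neg, one_pow, one_mul]

theorem bar_conv (φ ψ : Character) : bar (conv φ ψ) = conv (bar φ) (bar ψ) := by
  refine values.injective (funext fun τ => ?_)
  simp only [values_bar, values_conv, Pi.add_apply, mul_add, cutSum_apply,
    ← Multiset.sum_map_mul_left]
  refine congrArg (_ + Multiset.sum ·) (Multiset.map_congr rfl fun c hc => ?_)
  rw [Multiset.prod_map_mul, prod_map_pow_eq_pow_sum, ← RTree.size_cuts hc, pow_add]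
  ring

/-! ### Function spaces on trees that are closed under grafting -/

theorem prod_map_X_eq_monomial {σ R : Type*} [CommSemiring R] [DecidableEq σ] (s : Multiset σ) :
    (s.map MvPolynomial.X).prod = MvPolynomial.monomial (R := R) (Multiset.toFinsupp s) 1 := by
  induction s using Multiset.induction with
  | empty => simp
  | cons a s ih =>
    rw [Multiset.map_cons, Multiset.prod_cons, ih, ← Multiset.singleton_add, map_add,
      Multiset.toFinsupp_singleton, MvPolynomial.X, MvPolynomial.monomial_mul, one_mul]

section Independence

variable {K : Type*} [Field K] [Infinite K]

variable (K) in
theorem linearIndependent_prod_map (σ : Type*) :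
    LinearIndependent K fun (s : Multiset σ) (b : σ → K) => (s.map b).prod := by
  classical
  let evals : MvPolynomial σ K →ₗ[K] (σ → K) → K :=
    LinearMap.pi fun b => (MvPolynomial.aeval b).toLinearMap
  have hker : LinearMap.ker evals = ⊥ := LinearMap.ker_eq_bot'.mpr fun p hp =>
    MvPolynomial.funext fun b => by simpa [evals] using congrFun hp b
  have h := ((MvPolynomial.basisMonomials σ K).linearIndependent.comp _
    Multiset.toFinsupp.injective).map' evals hker
  have heq : (fun (s : Multiset σ) (b : σ → K) => (s.map b).prod) =
      evals ∘ MvPolynomial.basisMonomials σ K ∘ Multiset.toFinsupp := by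
    funext s b
    simp [evals, ← prod_map_X_eq_monomial, map_multiset_prod, Multiset.map_map]
  rw [heq]
  exact h

variable (K) in
theorem linearIndependent_graft : LinearIndependent K fun τ (b : RTree → K) => graft b τ :=
  (linearIndependent_prod_map K RTree).comp RTree.children RTree.children_injective

/-- The grafts of functions attaining all values on the smaller trees span all functions on the
trees with at most `k + 1` vertices, because distinct forests are linearly independent. -/
theorem exists_mem_eq_of_graft_mem (W : Submodule K (RTree → K)) (hW : ∀ b ∈ W, graft b ∈ W)
    (k : ℕ) (a : RTree → K) : ∃ w ∈ W, ∀ τ : RTree, τ.size ≤ k → w τ = a τ := by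
  classical
  induction k generalizing a with
  | zero => exact ⟨0, W.zero_mem, fun τ hτ => absurd hτ τ.size_pos.not_ge⟩
  | succ k ih =>
    let ρ : (RTree → K) →ₗ[K] (treesUpTo (k + 1) → K) := LinearMap.funLeft K K Subtype.val
    suffices htop : W.map ρ = ⊤ by
      obtain ⟨w, hw, hwa⟩ := (Submodule.mem_map (p := W)).mp (htop ▸ Submodule.mem_top (x := ρ a))
      exact ⟨w, hw, fun τ hτ => congrFun hwa ⟨τ, mem_treesUpTo.mpr hτ⟩⟩
    by_contra hne
    obtain ⟨ℓ, hℓ0, hℓ⟩ := Submodule.exists_le_ker_of_lt_top _ (lt_top_iff_ne_top.mpr hne)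
    have hrel : ∑ τ : treesUpTo (k + 1), ℓ (Pi.single τ 1) •
        (fun b : RTree → K => graft b τ.1) = 0 := by
      funext b
      obtain ⟨w, hw, hwb⟩ := ih b
      have hgraft : ρ (graft w) = fun τ => graft b τ.1 := funext fun τ =>
        graft_congr fun θ hθ => hwb θ (by have := mem_treesUpTo.mp τ.2; omega)
      have hzero : ℓ (ρ (graft w)) = 0 := hℓ (Submodule.mem_map_of_mem (hW w hw))
      rw [hgraft, pi_eq_sum_univ' (fun τ : treesUpTo (k + 1) => graft b τ.1), map_sum] at hzero
      simpa [mul_comm] using hzero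
    have hcoeff := Fintype.linearIndependent_iff.mp
      ((linearIndependent_graft K).comp _ Subtype.val_injective) _ hrel
    exact hℓ0 (LinearMap.pi_ext' fun τ => LinearMap.ext_ring (hcoeff τ))

end Independence

/-! ### Agreement up to terms of higher order in the step size -/

section Order

variable {X Y E F G : Type*} [TopologicalSpace X] [TopologicalSpace Y]
  [NormedAddCommGroup E] [NormedAddCommGroup F] [NormedAddCommGroup G]

/-- Two functions of the step size `h` and of a point agree up to order `k` if their difference is
`O(h ^ (k + 1))` as `h → 0`, locally uniformly in the point. -/
def EqUpToOrder (k : ℕ) (A B : ℝ × X → F) : Prop :=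
  ∀ y, (fun p => A p - B p) =O[𝓝 (0, y)] fun p => p.1 ^ (k + 1)

namespace EqUpToOrder

variable {k : ℕ} {A A' B B' C : ℝ × X → F}

theorem refl (A : ℝ × X → F) : EqUpToOrder k A A := fun y => by
  simpa using isBigO_zero _ _

theorem symm (h : EqUpToOrder k A B) : EqUpToOrder k B A := fun y =>
  (h y).neg_left.congr_left fun p => by simp

theorem trans (h : EqUpToOrder k A B) (h' : EqUpToOrder k B C) : EqUpToOrder k A C := fun y =>
  ((h y).add (h' y)).congr_left fun p => by simp

theorem add (h : EqUpToOrder k A B) (h' : EqUpToOrder k A' B') :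
    EqUpToOrder k (A + A') (B + B') := fun y =>
  ((h y).add (h' y)).congr_left fun p => by simp only [Pi.add_apply]; abel

theorem eq_zero_left (h : EqUpToOrder k A B) (y : X) : A (0, y) = B (0, y) := by
  obtain ⟨c, hc⟩ := (h y).bound
  simpa [sub_eq_zero] using hc.self_of_nhds

theorem comp_right {A B : ℝ × Y → F} (h : EqUpToOrder k A B) {u : ℝ × X → Y}
    (hu : Continuous u) :
    EqUpToOrder k (fun p => A (p.1, u p)) fun p => B (p.1, u p) := fun y =>
  (h (u (0, y))).comp_tendsto ((continuous_fst.prodMk hu).tendsto (0, y))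

variable [NormedSpace ℝ F] [NormedSpace ℝ G]

theorem smul {c : ℝ × X → ℝ} (hc : Continuous c) (h : EqUpToOrder k A B) :
    EqUpToOrder k (fun p => c p • A p) fun p => c p • B p := fun y =>
  (((hc.tendsto (0, y)).isBigO_one ℝ).smul (h y)).congr (fun p => smul_sub _ _ _) fun p => by simp

theorem comp_left (h : EqUpToOrder k A B) {g : ℝ × F → G} (hg : ContDiff ℝ 1 g)
    (hA : Continuous A) (hB : Continuous B) :
    EqUpToOrder k (fun p => g (p.1, A p)) fun p => g (p.1, B p) := fun y => by
  obtain ⟨K, t, ht, hK⟩ := (hg.contDiffAt (x := (0, A (0, y)))).exists_lipschitzOnWith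
  have htendsto : ∀ {D : ℝ × X → F}, Continuous D → D (0, y) = A (0, y) →
      ∀ᶠ p in 𝓝 (0, y), (p.1, D p) ∈ t := fun {D} hD hDA => by
    rw [← hDA] at ht
    exact (continuous_fst.prodMk hD).continuousAt ht
  refine (IsBigO.of_bound K ?_).trans (h y)
  filter_upwards [htendsto hA rfl, htendsto hB (h.eq_zero_left y).symm] with p hpA hpB
  simpa using hK.norm_sub_le hpA hpB

end EqUpToOrder

variable [NormedSpace ℝ E] [NormedSpace ℝ F]

theorem iteratedDeriv_eq_zero_of_isBigO {u : ℝ → F} (hu : ContDiff ℝ ∞ u) {k n : ℕ}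
    (h : u =O[𝓝 0] fun h : ℝ => h ^ (k + 1)) (hn : n ≤ k) : iteratedDeriv n u 0 = 0 := by
  induction n using Nat.strong_induction_on with
  | _ n ih =>
    set c := (n.factorial : ℝ)⁻¹ • iteratedDeriv n u 0 with hc
    have htaylor : (fun h : ℝ => u h - h ^ n • c) =o[𝓝 0] fun h => h ^ n := by
      refine (taylor_isLittleO_univ (n := n) (x₀ := (0 : ℝ))
        (hu.of_le (by exact_mod_cast le_top))).congr (fun h => ?_) fun h => by simp
      rw [taylor_within_apply, Finset.sum_range_succ, Finset.sum_eq_zero, zero_add]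
      · simp [hc, iteratedDerivWithin_univ, smul_smul, mul_comm]
      · intro m hm
        rw [Finset.mem_range] at hm
        rw [iteratedDerivWithin_univ, ih m hm (by omega), smul_zero]
    have hu' : u =o[𝓝 0] fun h : ℝ => h ^ n := h.trans_isLittleO (isLittleO_pow_pow (by omega))
    have hlead : (fun h : ℝ => h ^ n • c) =o[𝓝[≠] 0] fun h => h ^ n :=
      ((hu'.sub htaylor).congr_left fun h => by simp).mono nhdsWithin_le_nhds
    have hconst : Tendsto (fun _ : ℝ => c) (𝓝[≠] 0) (𝓝 0) := by
      refine hlead.tendsto_inv_smul_nhds_zero.congr' ?_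
      filter_upwards [self_mem_nhdsWithin] with h hh
      exact inv_smul_smul₀ (pow_ne_zero n hh) c
    exact (smul_eq_zero.mp (tendsto_nhds_unique tendsto_const_nhds hconst)).resolve_left
      (by positivity)

theorem contDiff_deriv_left {g : ℝ × E → F} (hg : ContDiff ℝ ∞ g) :
    ContDiff ℝ ∞ fun p : ℝ × E => deriv (fun h => g (h, p.2)) p.1 := by
  have hderiv (p : ℝ × E) : deriv (fun h => g (h, p.2)) p.1 = fderiv ℝ g p (1, 0) :=
    ((hg.differentiable (by simp) p).hasFDerivAt.comp_hasDerivAt p.1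
      ((hasDerivAt_id p.1).prodMk (hasDerivAt_const p.1 p.2))).deriv
  simp only [hderiv]
  exact (hg.fderiv_right (by simp)).clm_apply contDiff_const

theorem contDiff_curry_left {g : ℝ × E → F} (hg : ContDiff ℝ ∞ g) (z : E) :
    ContDiff ℝ ∞ fun h => g (h, z) :=
  hg.comp (contDiff_id.prodMk contDiff_const)

theorem isBigO_of_iteratedDeriv_eq_zero (m : ℕ) {g : ℝ × E → F} (hg : ContDiff ℝ ∞ g)
    (h0 : ∀ n < m, ∀ z, iteratedDeriv n (fun h => g (h, z)) 0 = 0) (y : E) :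
    g =O[𝓝 (0, y)] fun p => p.1 ^ m := by
  induction m generalizing g with
  | zero =>
    simp only [pow_zero]
    exact (hg.continuous.tendsto (0, y)).isBigO_one ℝ
  | succ m ih =>
    have hderiv : (fun p : ℝ × E => deriv (fun h => g (h, p.2)) p.1) =O[𝓝 (0, y)]
        fun p => p.1 ^ m := by
      refine ih (contDiff_deriv_left hg) fun n hn z => ?_
      have := h0 (n + 1) (by omega) z
      rwa [iteratedDeriv_succ'] at this
    obtain ⟨C, hC0, hC⟩ := hderiv.exists_pos
    obtain ⟨δ, hδ0, hδ⟩ := Metric.eventually_nhds_iff_ball.mp hC.bound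
    refine IsBigO.of_bound C ?_
    filter_upwards [Metric.ball_mem_nhds _ hδ0] with ⟨h, z⟩ hp
    have hmem : ∀ t ∈ Metric.closedBall (0 : ℝ) ‖h‖, (t, z) ∈ Metric.ball ((0 : ℝ), y) δ := by
      intro t ht
      rw [← ball_prod_same, Set.mem_prod, mem_ball_zero_iff] at hp ⊢
      exact ⟨(mem_closedBall_zero_iff.mp ht).trans_lt hp.1, hp.2⟩
    have hdiff : Differentiable ℝ fun t => g (t, z) :=
      (contDiff_curry_left hg z).differentiable (by simp)
    have hmvt : ‖g (h, z) - g (0, z)‖ ≤ C * ‖h‖ ^ m * ‖h - 0‖ :=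
      (convex_closedBall (0 : ℝ) ‖h‖).norm_image_sub_le_of_norm_deriv_le
        (f := fun t => g (t, z)) (fun t _ => hdiff t)
        (fun t ht => (hδ (t, z) (hmem t ht)).trans (by
          rw [norm_pow]
          gcongr
          exact mem_closedBall_zero_iff.mp ht))
        (by simp) (by simp)
    have hz0 : g (0, z) = 0 := by simpa using h0 0 (by omega) z
    simpa [hz0, pow_succ, mul_assoc] using hmvt

theorem iteratedDeriv_sub_curry_left {A B : ℝ × E → F} (hA : ContDiff ℝ ∞ A)
    (hB : ContDiff ℝ ∞ B) (n : ℕ) (z : E) (h : ℝ) :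
    iteratedDeriv n (fun h => A (h, z) - B (h, z)) h =
      iteratedDeriv n (fun h => A (h, z)) h - iteratedDeriv n (fun h => B (h, z)) h :=
  iteratedDeriv_fun_sub
    ((contDiff_curry_left hA z).contDiffAt.of_le (by exact_mod_cast le_top))
    ((contDiff_curry_left hB z).contDiffAt.of_le (by exact_mod_cast le_top))

theorem iteratedDeriv_eq_of_isBigO {A B : ℝ × E → F} (hA : ContDiff ℝ ∞ A) (hB : ContDiff ℝ ∞ B)
    {k n : ℕ} {z : E} (h : (fun h => A (h, z) - B (h, z)) =O[𝓝 0] fun h : ℝ => h ^ (k + 1))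
    (hn : n ≤ k) :
    iteratedDeriv n (fun h => A (h, z)) 0 = iteratedDeriv n (fun h => B (h, z)) 0 := by
  rw [← sub_eq_zero, ← iteratedDeriv_sub_curry_left hA hB]
  exact iteratedDeriv_eq_zero_of_isBigO
    ((contDiff_curry_left hA z).sub (contDiff_curry_left hB z)) h hn

theorem EqUpToOrder.iteratedDeriv_eq {k n : ℕ} {A B : ℝ × E → F} (h : EqUpToOrder k A B)
    (hA : ContDiff ℝ ∞ A) (hB : ContDiff ℝ ∞ B) (hn : n ≤ k) (z : E) :
    iteratedDeriv n (fun h => A (h, z)) 0 = iteratedDeriv n (fun h => B (h, z)) 0 :=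
  iteratedDeriv_eq_of_isBigO hA hB
    ((h z).comp_tendsto (Continuous.tendsto' (by fun_prop) 0 (0, z) rfl)) hn

theorem eqUpToOrder_of_iteratedDeriv_eq {k : ℕ} {A B : ℝ × E → F} (hA : ContDiff ℝ ∞ A)
    (hB : ContDiff ℝ ∞ B)
    (h : ∀ n ≤ k, ∀ z,
      iteratedDeriv n (fun h => A (h, z)) 0 = iteratedDeriv n (fun h => B (h, z)) 0) :
    EqUpToOrder k A B :=
  isBigO_of_iteratedDeriv_eq_zero (k + 1) (hA.sub hB) fun n hn z => by
    rw [iteratedDeriv_sub_curry_left hA hB, h n (by omega) z, sub_self]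

theorem eqUpToOrder_of_forall_isBigO {k : ℕ} {A B : ℝ × E → F} (hA : ContDiff ℝ ∞ A)
    (hB : ContDiff ℝ ∞ B)
    (h : ∀ z, (fun h => A (h, z) - B (h, z)) =O[𝓝 0] fun h : ℝ => h ^ (k + 1)) :
    EqUpToOrder k A B :=
  eqUpToOrder_of_iteratedDeriv_eq hA hB fun _ hn z => iteratedDeriv_eq_of_isBigO hA hB (h z) hn

end Order

/-! ### The monoids of formal maps and of methods -/

namespace FormalMap

variable {E : Type*} [NormedAddCommGroup E] [NormedSpace ℝ E]

theorem iteratedDeriv_trunc (A : FormalMap E) {n k : ℕ} (hn : n ≤ k) (y : E) :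
    iteratedDeriv n (fun h => A.trunc k h y) 0 = (n.factorial : ℝ) • A.coeff n y := by
  have hterm : ∀ j, iteratedDeriv n (fun h : ℝ => h ^ j • A.coeff j y) 0 =
      (if n = j then (n.factorial : ℝ) else 0) • A.coeff j y := fun j => by
    rw [iteratedDeriv_smul_const (contDiff_id.pow j).contDiffAt, iteratedDeriv_fun_pow_zero]
    split_ifs with hnj <;> simp [hnj]
  simp only [trunc]
  rw [iteratedDeriv_fun_sum fun j _ => by fun_prop]
  simp_rw [hterm, ite_smul, zero_smul]
  rw [Finset.sum_ite_eq, if_pos (Finset.mem_range.mpr (by omega))]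

theorem eqUpToOrder_trunc_trunc (A : FormalMap E) {n k : ℕ} (hnk : n ≤ k) :
    EqUpToOrder n (fun p => A.trunc k p.1 p.2) fun p => A.trunc n p.1 p.2 :=
  eqUpToOrder_of_iteratedDeriv_eq (A.trunc_smooth k) (A.trunc_smooth n) fun m hm z => by
    simp only [A.iteratedDeriv_trunc hm, A.iteratedDeriv_trunc (hm.trans hnk)]

theorem ext_of_eqUpToOrder {A B : FormalMap E}
    (h : ∀ k, EqUpToOrder k (fun p => A.trunc k p.1 p.2) fun p => B.trunc k p.1 p.2) :
    A = B := by
  ext k y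
  have hderiv := (h k).iteratedDeriv_eq (A.trunc_smooth k) (B.trunc_smooth k) le_rfl y
  simp only [iteratedDeriv_trunc _ le_rfl] at hderiv
  exact smul_right_injective E (Nat.cast_ne_zero.mpr k.factorial_ne_zero) hderiv

theorem continuous_trunc (A : FormalMap E) (k : ℕ) :
    Continuous fun p : ℝ × E => A.trunc k p.1 p.2 :=
  (A.trunc_smooth k).continuous

theorem contDiff_trunc_trunc (A B : FormalMap E) (k : ℕ) :
    ContDiff ℝ ∞ fun p : ℝ × E => A.trunc k p.1 (B.trunc k p.1 p.2) :=
  (A.trunc_smooth k).comp (contDiff_fst.prodMk (B.trunc_smooth k))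

theorem eqUpToOrder_trunc_comp (A B : FormalMap E) (k : ℕ) :
    EqUpToOrder k (fun p => (A.comp B).trunc k p.1 p.2)
      fun p => A.trunc k p.1 (B.trunc k p.1 p.2) := by
  refine eqUpToOrder_of_iteratedDeriv_eq ((A.comp B).trunc_smooth k)
    (A.contDiff_trunc_trunc B k) fun n hn z => ?_
  have hnk : EqUpToOrder n (fun p => A.trunc n p.1 (B.trunc n p.1 p.2))
      fun p => A.trunc k p.1 (B.trunc k p.1 p.2) :=
    ((B.eqUpToOrder_trunc_trunc hn).symm.comp_left ((A.trunc_smooth n).of_le (by simp))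
      (B.continuous_trunc n) (B.continuous_trunc k)).trans
    ((A.eqUpToOrder_trunc_trunc hn).symm.comp_right (B.continuous_trunc k))
  calc iteratedDeriv n (fun h => (A.comp B).trunc k h z) 0
      = (n.factorial : ℝ) • (A.comp B).coeff n z := iteratedDeriv_trunc _ hn z
    _ = iteratedDeriv n (fun h => A.trunc n h (B.trunc n h z)) 0 :=
        smul_inv_smul₀ (Nat.cast_ne_zero.mpr n.factorial_ne_zero) _
    _ = iteratedDeriv n (fun h => A.trunc k h (B.trunc k h z)) 0 :=
        hnk.iteratedDeriv_eq (A.contDiff_trunc_trunc B n) (A.contDiff_trunc_trunc B k) le_rfl z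

theorem comp_eq_of_eqUpToOrder {A B C : FormalMap E}
    (h : ∀ k, EqUpToOrder k (fun p => A.trunc k p.1 (B.trunc k p.1 p.2))
      fun p => C.trunc k p.1 p.2) : A.comp B = C :=
  ext_of_eqUpToOrder fun k => (A.eqUpToOrder_trunc_comp B k).trans (h k)

theorem comp_assoc (A B C : FormalMap E) : (A.comp B).comp C = A.comp (B.comp C) := by
  refine comp_eq_of_eqUpToOrder fun k => ?_
  have hAB := (A.eqUpToOrder_trunc_comp B k).comp_right (C.continuous_trunc k)
  have hBC : EqUpToOrder k (fun p => A.trunc k p.1 (B.trunc k p.1 (C.trunc k p.1 p.2)))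
      fun p => A.trunc k p.1 ((B.comp C).trunc k p.1 p.2) :=
    (B.eqUpToOrder_trunc_comp C k).symm.comp_left ((A.trunc_smooth k).of_le (by simp))
      (B.contDiff_trunc_trunc C k).continuous ((B.comp C).continuous_trunc k)
  exact (hAB.trans hBC).trans (A.eqUpToOrder_trunc_comp (B.comp C) k).symm

theorem trunc_one (k : ℕ) (h : ℝ) (y : E) : (one : FormalMap E).trunc k h y = y := by
  rw [trunc, Finset.sum_range_succ']
  simp [one]

theorem one_comp (A : FormalMap E) : one.comp A = A :=
  comp_eq_of_eqUpToOrder fun k => by simpa only [trunc_one] using EqUpToOrder.refl _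

theorem comp_one (A : FormalMap E) : A.comp one = A :=
  comp_eq_of_eqUpToOrder fun k => by simpa only [trunc_one] using EqUpToOrder.refl _

instance : Monoid (FormalMap E) where
  mul := comp
  one := one
  mul_assoc := comp_assoc
  one_mul := one_comp
  mul_one := comp_one

end FormalMap

instance : Monoid Method :=
  inferInstanceAs (Monoid (∀ N : ℕ, VectorField N → FormalMap (EuclideanSpace ℝ (Fin N))))

/-! ### Taylor expansion of vector fields -/

section Taylor

variable {E F : Type*} [NormedAddCommGroup E] [NormedSpace ℝ E] [NormedAddCommGroup F]
  [NormedSpace ℝ F]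

theorem norm_sub_taylor_le [CompleteSpace F] {f : E → F} {n : ℕ} {x v : E} {C : ℝ}
    (hf : ContDiff ℝ (n + 1) f)
    (hC : ∀ t ∈ Set.Icc (0 : ℝ) 1, ‖iteratedFDeriv ℝ (n + 1) f (x + t • v)‖ ≤ C) :
    ‖f (x + v) - ∑ m ∈ Finset.range (n + 1),
      (m.factorial : ℝ)⁻¹ • iteratedFDeriv ℝ m f x fun _ => v‖ ≤
        (n.factorial : ℝ)⁻¹ * (C * ‖v‖ ^ (n + 1)) := by
  have hintegrand : ∀ t ∈ Set.uIoc (0 : ℝ) 1,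
      ‖(1 - t) ^ n • iteratedFDeriv ℝ (n + 1) f (x + t • v) fun _ => v‖ ≤ C * ‖v‖ ^ (n + 1) := by
    intro t ht
    rw [Set.uIoc_of_le zero_le_one] at ht
    have hpow : ‖(1 - t) ^ n‖ ≤ 1 := by
      rw [norm_pow, Real.norm_of_nonneg (by linarith [ht.2])]
      exact pow_le_one₀ (by linarith [ht.2]) (by linarith [ht.1])
    calc ‖(1 - t) ^ n • iteratedFDeriv ℝ (n + 1) f (x + t • v) fun _ => v‖
        ≤ 1 * (C * ‖v‖ ^ (n + 1)) := by
          rw [norm_smul]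
          gcongr
          exact (ContinuousMultilinearMap.le_opNorm_mul_pow_of_le _ (pi_norm_const_le v)).trans
            (by gcongr; exact hC t (Set.Ioc_subset_Icc_self ht))
      _ = C * ‖v‖ ^ (n + 1) := one_mul _
  rw [map_add_eq_sum_add_integral_iteratedFDeriv fun t _ => hf.contDiffAt, add_sub_cancel_left,
    norm_smul, norm_inv, Real.norm_natCast]
  gcongr
  simpa using intervalIntegral.norm_integral_le_of_norm_le_const hintegrand

theorem taylor_add_isBigO [CompleteSpace F] {f : E → F} {n : ℕ} (hf : ContDiff ℝ (n + 1) f)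
    (x : E) :
    (fun v => f (x + v) - ∑ m ∈ Finset.range (n + 1),
      (m.factorial : ℝ)⁻¹ • iteratedFDeriv ℝ m f x fun _ => v) =O[𝓝 0] fun v => ‖v‖ ^ (n + 1) := by
  have hcont : Continuous (iteratedFDeriv ℝ (n + 1) f) :=
    hf.continuous_iteratedFDeriv (by norm_cast)
  obtain ⟨C, hbound⟩ := ((hcont.tendsto x).isBigO_one ℝ).bound
  obtain ⟨δ, hδ, hball⟩ := Metric.eventually_nhds_iff_ball.mp hbound
  refine IsBigO.of_bound ((n.factorial : ℝ)⁻¹ * C) ?_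
  filter_upwards [Metric.ball_mem_nhds 0 hδ] with v hv
  have hv' : x + v ∈ Metric.ball x δ := by simpa using hv
  have hsegment : ∀ t ∈ Set.Icc (0 : ℝ) 1, x + t • v ∈ Metric.ball x δ := fun t ht =>
    (convex_ball x δ).add_smul_mem (Metric.mem_ball_self hδ) hv' ht
  have htaylor := norm_sub_taylor_le hf fun t ht => by
    simpa using hball _ (hsegment t ht)
  simpa [mul_assoc] using htaylor

theorem derivApply_ofFn (f : E → E) {m : ℕ} (v : Fin m → E) (y : E) :
    derivApply f (List.ofFn v) y = iteratedFDeriv ℝ m f y v := by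
  have hcast : ∀ (n : ℕ) (hn : n = m) (w : Fin n → E), (∀ i, w i = v (Fin.cast hn i)) →
      iteratedFDeriv ℝ n f y w = iteratedFDeriv ℝ m f y v := by
    rintro n rfl w hw
    exact congrArg _ (funext hw)
  exact hcast _ List.length_ofFn _ fun i => by simp [Fin.cast]

end Taylor

theorem elemDiff_node_map {N m : ℕ} (f : VectorField N) (r : Fin m → RTree)
    (y : EuclideanSpace ℝ (Fin N)) :
    elemDiff f (RTree.node (Finset.univ.val.map r)) y =
      iteratedFDeriv ℝ m f.toFun y fun i => elemDiff f (r i) y := by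
  have hmk : ∀ t : PTree, elemDiff f (RTree.mk t) = PTree.elem f.toFun t := fun _ => rfl
  have hr : (Finset.univ.val.map r : Multiset RTree) =
      ((List.ofFn fun i => (r i).rep).map RTree.mk : List RTree) := by
    simp [List.map_ofFn, Fin.univ_val_map, Function.comp_def, RTree.mk_rep]
  rw [hr, RTree.node_map_mk, hmk, PTree.elem]
  simp only [PTree.elemList_eq_map, List.map_ofFn, derivApply_ofFn, Function.comp_def, ← hmk,
    RTree.mk_rep]

/-- Both sides are linear images of the multinomial expansion of `(∑ i ∈ S, X i) ^ m`. -/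
theorem sum_piFinset_eq_sum_sym {ι M : Type*} [DecidableEq ι] [AddCommMonoid M] (S : Finset ι)
    (m : ℕ) (G : Multiset ι → M) :
    ∑ r ∈ Fintype.piFinset fun _ : Fin m => S, G (Finset.univ.val.map r) =
      ∑ s ∈ S.sym m, s.val.countPerms • G s.val := by
  let L : MvPolynomial ι ℕ →ₗ[ℕ] M := (MvPolynomial.basisMonomials ι ℕ).constr ℕ
    fun d => G (Finsupp.toMultiset d)
  have hL : ∀ s : Multiset ι, L (s.map MvPolynomial.X).prod = G s := fun s => by
    have hbasis : (s.map MvPolynomial.X).prod =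
        MvPolynomial.basisMonomials ι ℕ (Multiset.toFinsupp s) := by
      rw [prod_map_X_eq_monomial, MvPolynomial.coe_basisMonomials]
    rw [hbasis, Module.Basis.constr_basis, Multiset.toFinsupp_toMultiset]
  calc ∑ r ∈ Fintype.piFinset fun _ : Fin m => S, G (Finset.univ.val.map r)
      = L (∑ r ∈ Fintype.piFinset fun _ : Fin m => S, ∏ i, MvPolynomial.X (r i)) := by
        simp only [map_sum, ← hL, Multiset.map_map]
        rfl
    _ = L (∑ s ∈ S.sym m, s.val.countPerms • (s.val.map MvPolynomial.X).prod) := by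
        simp only [nsmul_eq_mul, ← Finset.sum_pow', Finset.sum_pow]
    _ = ∑ s ∈ S.sym m, s.val.countPerms • G s.val := by
        simp only [map_sum, map_nsmul, hL]

theorem multFactorial_mul_countPerms [DecidableEq RTree] (s : Multiset RTree) :
    multFactorial s * s.countPerms = s.card.factorial := by
  have hspec := Nat.multinomial_spec s.toFinset fun τ => s.count τ
  rw [Multiset.toFinset_sum_count_eq] at hspec
  rw [← hspec, Multiset.countPerms, Finsupp.multinomial_eq, Multiset.toFinsupp_support]
  refine congrArg₂ (· * ·) ?_ (Nat.multinomial_congr fun τ _ => by simp)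
  unfold multFactorial
  congr!

/-! ### B-series with arbitrary coefficients -/

section BSum

variable {N : ℕ} (f : VectorField N)

/-- The term `h ^ |τ| b(τ) / σ(τ) F(τ)(y)` of a B-series, as a function of `(h, y)`. -/
def bTerm (b : RTree → ℝ) (τ : RTree) (p : ℝ × EuclideanSpace ℝ (Fin N)) :
    EuclideanSpace ℝ (Fin N) :=
  p.1 ^ τ.size • (b τ / (τ.sigma : ℝ)) • elemDiff f τ p.2

/-- The part of the B-series with coefficients `b` coming from the non-empty trees with at most `k`
vertices, as a function of `(h, y)`. -/
def bSum (k : ℕ) : (RTree → ℝ) →ₗ[ℝ]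
    ℝ × EuclideanSpace ℝ (Fin N) → EuclideanSpace ℝ (Fin N) where
  toFun b p := ∑ τ ∈ treesUpTo k, bTerm f b τ p
  map_add' b b' := by
    funext p
    simp [bTerm, add_div, add_smul, Finset.sum_add_distrib]
  map_smul' r b := by
    funext p
    simp [bTerm, Finset.smul_sum, mul_div_assoc, mul_smul, smul_comm r]

theorem bSum_apply (k : ℕ) (b : RTree → ℝ) (p : ℝ × EuclideanSpace ℝ (Fin N)) :
    bSum f k b p = ∑ τ ∈ treesUpTo k, bTerm f b τ p := rfl

theorem bSum_congr {k : ℕ} {b b' : RTree → ℝ} (hb : ∀ τ : RTree, τ.size ≤ k → b τ = b' τ) :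
    bSum f k b = bSum f k b' :=
  funext fun _ => Finset.sum_congr rfl fun τ hτ => by rw [bTerm, bTerm, hb τ (mem_treesUpTo.mp hτ)]

theorem contDiff_bTerm (b : RTree → ℝ) (τ : RTree) : ContDiff ℝ ∞ (bTerm f b τ) :=
  (contDiff_fst.pow _).smul (((elemDiff_smooth f τ).comp contDiff_snd).const_smul _)

theorem contDiff_bSum (k : ℕ) (b : RTree → ℝ) : ContDiff ℝ ∞ (bSum f k b) :=
  ContDiff.sum fun τ _ => contDiff_bTerm f b τ

theorem bTerm_isBigO (b : RTree → ℝ) {τ : RTree} {n : ℕ} (hn : n ≤ τ.size)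
    (y : EuclideanSpace ℝ (Fin N)) : bTerm f b τ =O[𝓝 (0, y)] fun p => p.1 ^ n := by
  have hcont : Continuous fun p : ℝ × EuclideanSpace ℝ (Fin N) =>
      p.1 ^ (τ.size - n) • (b τ / (τ.sigma : ℝ)) • elemDiff f τ p.2 :=
    (continuous_fst.pow _).smul
      (((elemDiff_smooth f τ).continuous.comp continuous_snd).const_smul (b τ / (τ.sigma : ℝ)))
  refine ((isBigO_refl (fun p : ℝ × EuclideanSpace ℝ (Fin N) => p.1 ^ n) _).smul
    ((hcont.tendsto (0, y)).isBigO_one ℝ)).congr (fun p => ?_) fun p => by simp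
  rw [smul_smul, ← pow_add, Nat.add_sub_cancel' hn, bTerm]

theorem bSum_isBigO (b : RTree → ℝ) (k : ℕ) (y : EuclideanSpace ℝ (Fin N)) :
    bSum f k b =O[𝓝 (0, y)] fun p => p.1 := by
  have hsum : bSum f k b =O[𝓝 (0, y)] fun p => p.1 ^ 1 :=
    IsBigO.fun_sum fun τ _ => bTerm_isBigO f b τ.size_pos y
  simpa using hsum

theorem eqUpToOrder_sum_bTerm (b : RTree → ℝ) {k : ℕ} {T : Finset RTree} (hT : treesUpTo k ⊆ T) :
    EqUpToOrder k (fun p => ∑ τ ∈ T, bTerm f b τ p) (bSum f k b) := fun y => by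
  classical
  have hrest : (fun p => ∑ τ ∈ T \ treesUpTo k, bTerm f b τ p) =O[𝓝 (0, y)]
      fun p => p.1 ^ (k + 1) :=
    IsBigO.fun_sum fun τ hτ => bTerm_isBigO f b
      (by simpa [Nat.succ_le_iff] using (Finset.mem_sdiff.mp hτ).2) y
  exact hrest.congr_left fun p => by
    simp only [bSum_apply, ← Finset.sum_sdiff hT, add_sub_cancel_right]

theorem trunc_bSeries (φ : Character) (k : ℕ) (h : ℝ) (y : EuclideanSpace ℝ (Fin N)) :
    (bSeries φ N f).trunc k h y = y + bSum f k (values φ) (h, y) := by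
  rw [FormalMap.trunc, bSum_apply, sum_treesUpTo, Finset.sum_range_succ', Finset.sum_range_succ',
    treesOfSize_zero, Finset.sum_empty, add_zero, add_comm]
  simp only [bSeries, pow_zero, one_smul, if_true]
  refine congrArg _ (Finset.sum_congr rfl fun n _ => ?_)
  rw [if_neg n.succ_ne_zero, Finset.smul_sum]
  refine Finset.sum_congr rfl fun τ hτ => ?_
  rw [bTerm, mem_treesOfSize.mp hτ, values_apply]

/-! ### The vector field along a B-series -/

theorem pow_size_node_mul_graft_div_sigma [DecidableEq RTree] (b : RTree → ℝ) (h : ℝ)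
    (s : Multiset RTree) :
    h ^ (RTree.node s).size * (graft b (RTree.node s) / ((RTree.node s).sigma : ℝ)) =
      h * ((s.card.factorial : ℝ)⁻¹ * (s.countPerms *
        (s.map fun τ => h ^ τ.size * (b τ / (τ.sigma : ℝ))).prod)) := by
  have hcount : (multFactorial s : ℝ) * s.countPerms = s.card.factorial := by
    exact_mod_cast multFactorial_mul_countPerms s
  have hfactorial : (s.card.factorial : ℝ) ≠ 0 := by positivity
  rw [← hcount] at hfactorial
  have hmult := left_ne_zero_of_mul hfactorial
  have hperms := right_ne_zero_of_mul hfactorial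
  rw [Multiset.prod_map_mul, Multiset.prod_map_div, prod_map_pow_eq_pow_sum, RTree.size_node,
    RTree.sigma_node, graft_node, pow_add, pow_one, Nat.cast_mul, Nat.cast_multiset_prod,
    Multiset.map_map, Function.comp_def, ← hcount]
  field_simp

theorem smul_iteratedFDeriv_bSum [DecidableEq RTree] (b : RTree → ℝ) (k m : ℕ)
    (p : ℝ × EuclideanSpace ℝ (Fin N)) :
    p.1 • (m.factorial : ℝ)⁻¹ • (iteratedFDeriv ℝ m f.toFun p.2 fun _ => bSum f k b p) =
      ∑ s ∈ (treesUpTo k).sym m, bTerm f (graft b) (RTree.node s.val) p := by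
  let c : RTree → ℝ := fun τ => p.1 ^ τ.size * (b τ / (τ.sigma : ℝ))
  have hexpand : (iteratedFDeriv ℝ m f.toFun p.2 fun _ => bSum f k b p) =
      ∑ r ∈ Fintype.piFinset fun _ : Fin m => treesUpTo k,
        ((Finset.univ.val.map r).map c).prod •
          elemDiff f (RTree.node (Finset.univ.val.map r)) p.2 := by
    simp only [bSum_apply, bTerm, smul_smul]
    rw [ContinuousMultilinearMap.map_sum_finset]
    refine Finset.sum_congr rfl fun r _ => ?_
    rw [ContinuousMultilinearMap.map_smul_univ, elemDiff_node_map, Multiset.map_map]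
    rfl
  rw [hexpand, sum_piFinset_eq_sum_sym _ _
    fun s => (s.map c).prod • elemDiff f (RTree.node s) p.2, Finset.smul_sum, Finset.smul_sum]
  refine Finset.sum_congr rfl fun ⟨s, hs⟩ _ => ?_
  subst hs
  simp only [bTerm, ← Nat.cast_smul_eq_nsmul ℝ, smul_smul, c, pow_size_node_mul_graft_div_sigma]

theorem exists_finset_sum_sym_eq [DecidableEq RTree] (M : Type*) [AddCommMonoid M] (k : ℕ) :
    ∃ T : Finset RTree, treesUpTo k ⊆ T ∧ ∀ g : RTree → M,
      ∑ m ∈ Finset.range (k + 1), ∑ s ∈ (treesUpTo k).sym m, g (RTree.node s.val) =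
        ∑ τ ∈ T, g τ := by
  let S := (Finset.range (k + 1)).sigma fun m => (treesUpTo k).sym m
  let node : (Σ m, Sym RTree m) → RTree := fun x => RTree.node x.2.val
  have hnode : Function.Injective node := by
    rintro ⟨_, ⟨s, rfl⟩⟩ ⟨_, ⟨s', rfl⟩⟩ h
    obtain rfl : s = s' := RTree.node_injective h
    rfl
  refine ⟨S.image node, fun τ hτ => ?_, fun g => ?_⟩
  · rw [mem_treesUpTo] at hτ
    refine Finset.mem_image.mpr ⟨⟨_, ⟨τ.children, rfl⟩⟩, ?_, τ.node_children⟩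
    have := τ.card_children_lt_size
    refine Finset.mem_sigma.mpr ⟨Finset.mem_range.mpr (by dsimp only; omega),
      Finset.mem_sym_iff.mpr fun θ hθ => mem_treesUpTo.mpr ?_⟩
    exact (RTree.size_lt_of_mem_children hθ).le.trans hτ
  · rw [Finset.sum_image hnode.injOn, Finset.sum_sigma]

theorem eqUpToOrder_smul_taylor [DecidableEq RTree] (b : RTree → ℝ) (k : ℕ) :
    EqUpToOrder k (fun p => p.1 • f.toFun (p.2 + bSum f k b p)) fun p =>
      ∑ m ∈ Finset.range (k + 1), ∑ s ∈ (treesUpTo k).sym m,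
        bTerm f (graft b) (RTree.node s.val) p := by
  refine eqUpToOrder_of_forall_isBigO
    (contDiff_fst.smul (f.smooth.comp (contDiff_snd.add (contDiff_bSum f k b))))
    (ContDiff.sum fun m _ => ContDiff.sum fun s _ => contDiff_bTerm f _ _) fun z => ?_
  have hline : Tendsto (fun h : ℝ => (h, z)) (𝓝 0) (𝓝 (0, z)) :=
    Continuous.tendsto' (by fun_prop) _ _ rfl
  have hbSum : (fun h => bSum f k b (h, z)) =O[𝓝 0] fun h : ℝ => h :=
    (bSum_isBigO f b k z).comp_tendsto hline
  have hremainder := ((taylor_add_isBigO (n := k) (f.smooth.of_le (by exact_mod_cast le_top)) z)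
    |>.comp_tendsto (hbSum.trans_tendsto tendsto_id)).trans (hbSum.norm_left.pow (k + 1))
  refine (((continuous_id.tendsto (0 : ℝ)).isBigO_one ℝ).smul hremainder).congr
    (fun h => ?_) fun h => by simp
  simp only [id, Function.comp_apply, smul_sub, Finset.smul_sum]
  exact congrArg _ (Finset.sum_congr rfl fun m _ => smul_iteratedFDeriv_bSum f b k m (h, z))

theorem eqUpToOrder_bSum_graft (b : RTree → ℝ) (k : ℕ) :
    EqUpToOrder k (bSum f k (graft b)) fun p => p.1 • f.toFun (p.2 + bSum f k b p) := by
  classical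
  obtain ⟨T, hT, hsum⟩ := exists_finset_sum_sym_eq (EuclideanSpace ℝ (Fin N)) k
  have htaylor := eqUpToOrder_smul_taylor f b k
  simp only [fun p => hsum fun τ => bTerm f (graft b) τ p] at htaylor
  exact (htaylor.trans (eqUpToOrder_sum_bTerm f (graft b) hT)).symm

/-! ### Composition of B-series -/

/-- The functions `b` on trees for which substituting the B-series of `a` into the one of `b` gives
the B-series of `cutSum a b`, up to order `k`. -/
def substitutable (a : RTree → ℝ) (k : ℕ) : Submodule ℝ (RTree → ℝ) where
  carrier := {b | EqUpToOrder k (fun p => bSum f k b (p.1, p.2 + bSum f k a p))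
    (bSum f k (cutSum a b))}
  zero_mem' := by
    rw [Set.mem_ofPred_eq, map_zero, map_zero, map_zero]
    exact EqUpToOrder.refl (0 : ℝ × EuclideanSpace ℝ (Fin N) → EuclideanSpace ℝ (Fin N))
  add_mem' hb hb' := by
    rw [Set.mem_ofPred_eq, map_add, map_add, map_add]
    exact EqUpToOrder.add hb hb'
  smul_mem' r b hb := by
    rw [Set.mem_ofPred_eq, map_smul, map_smul, map_smul]
    exact EqUpToOrder.smul (continuous_const (y := r)) hb

theorem graft_mem_substitutable (a : RTree → ℝ) (k : ℕ) (b : RTree → ℝ)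
    (hb : b ∈ substitutable f a k) : graft b ∈ substitutable f a k := by
  have hcont := fun b => (contDiff_bSum f k b).continuous
  let z : ℝ × EuclideanSpace ℝ (Fin N) → EuclideanSpace ℝ (Fin N) := fun p => p.2 + bSum f k a p
  have hz : Continuous z := continuous_snd.add (hcont a)
  have houter := (eqUpToOrder_bSum_graft f b k).comp_right hz
  have hinner : EqUpToOrder k (z + fun p => bSum f k b (p.1, z p)) (z + bSum f k (cutSum a b)) :=
    (EqUpToOrder.refl z).add hb
  have hfield : ContDiff ℝ 1 fun p : ℝ × EuclideanSpace ℝ (Fin N) => p.1 • f.toFun p.2 :=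
    contDiff_fst.smul ((f.smooth.of_le (by simp)).comp contDiff_snd)
  have hmiddle := hinner.comp_left hfield (hz.add ((hcont b).comp (continuous_fst.prodMk hz)))
    (hz.add (hcont (cutSum a b)))
  have hresult := (eqUpToOrder_bSum_graft f (a + cutSum a b) k).symm
  simp only [map_add, Pi.add_apply, ← add_assoc] at hresult
  change EqUpToOrder k _ (bSum f k (cutSum a (graft b)))
  rw [cutSum_graft]
  exact (houter.trans hmiddle).trans hresult

theorem eqUpToOrder_bSum_add_bSum (a b : RTree → ℝ) (k : ℕ) :
    EqUpToOrder k (fun p => bSum f k b (p.1, p.2 + bSum f k a p)) (bSum f k (cutSum a b)) := by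
  obtain ⟨w, hw, hwb⟩ := exists_mem_eq_of_graft_mem (substitutable f a k)
    (graft_mem_substitutable f a k) k b
  have hcut : bSum f k (cutSum a w) = bSum f k (cutSum a b) :=
    bSum_congr f fun τ hτ => cutSum_congr a fun θ hθ => hwb θ (hθ.trans hτ)
  rw [← bSum_congr f hwb, ← hcut]
  exact hw

end BSum

theorem bSeries_conv (φ ψ : Character) : bSeries (conv φ ψ) = bSeries ψ * bSeries φ := by
  funext N f
  refine (FormalMap.comp_eq_of_eqUpToOrder fun k => ?_).symm
  simp only [trunc_bSeries, values_conv, map_add, Pi.add_apply, ← add_assoc]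
  exact (EqUpToOrder.refl fun p => p.2 + bSum f k (values φ) p).add
    (eqUpToOrder_bSum_add_bSum f (values φ) (values ψ) k)

/-! ### Independence of the elementary differentials -/

section Semiconj

variable {E E' : Type*} [NormedAddCommGroup E] [NormedSpace ℝ E] [NormedAddCommGroup E']
  [NormedSpace ℝ E'] {f : E → E} {g : E' → E'} {A : E →L[ℝ] E'}

theorem semiconj_dirDeriv (hf : ContDiff ℝ ∞ f) (hg : ContDiff ℝ ∞ g)
    (h : Function.Semiconj A f g) (l : List E) :
    Function.Semiconj A (dirDeriv f l) (dirDeriv g (l.map A)) := by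
  induction l with
  | nil => exact h
  | cons v l ih =>
    intro y
    have hleft : HasFDerivAt (A ∘ dirDeriv f l) (A.comp (fderiv ℝ (dirDeriv f l) y)) y :=
      A.hasFDerivAt.comp y ((dirDeriv_smooth hf l).differentiable (by simp) y).hasFDerivAt
    have hright : HasFDerivAt (dirDeriv g (l.map A) ∘ A)
        ((fderiv ℝ (dirDeriv g (l.map A)) (A y)).comp A) y :=
      ((dirDeriv_smooth hg _).differentiable (by simp) (A y)).hasFDerivAt.comp y A.hasFDerivAt
    rw [ih.comp_eq] at hleft
    exact DFunLike.congr_fun (hleft.unique hright) v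

mutual
theorem semiconj_elem (hf : ContDiff ℝ ∞ f) (hg : ContDiff ℝ ∞ g) (h : Function.Semiconj A f g) :
    ∀ t : PTree, Function.Semiconj A (PTree.elem f t) (PTree.elem g t)
  | .node ts => fun y => by
    simp only [PTree.elem, derivApply_eq_dirDeriv hf, derivApply_eq_dirDeriv hg]
    rw [semiconj_dirDeriv hf hg h _ y, map_elemList hf hg h ts y]
theorem map_elemList (hf : ContDiff ℝ ∞ f) (hg : ContDiff ℝ ∞ g) (h : Function.Semiconj A f g) :
    ∀ (ts : List PTree) (y : E), (PTree.elemList f ts y).map A = PTree.elemList g ts (A y)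
  | [], _ => by simp [PTree.elemList]
  | t :: ts, y => by
    rw [PTree.elemList, PTree.elemList, List.map_cons, semiconj_elem hf hg h t y,
      map_elemList hf hg h ts y]
end

/-- The vector field `(x, z) ↦ (exp (ℓ (z - y)), f z)`. It turns grafting into multiplication: at
the point `(x, y)` every derivative of its first component is the product of the values of `ℓ` at
the directions. -/
def expExtension (f : E → E) (y : E) (ℓ : E →L[ℝ] ℝ) (p : ℝ × E) : ℝ × E :=
  (Real.exp (ℓ (p.2 - y)), f p.2)

theorem contDiff_expExtension (hf : ContDiff ℝ ∞ f) (y : E) (ℓ : E →L[ℝ] ℝ) :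
    ContDiff ℝ ∞ (expExtension f y ℓ) :=
  (Real.contDiff_exp.comp (ℓ.contDiff.comp (contDiff_snd.sub contDiff_const))).prodMk
    (hf.comp contDiff_snd)

theorem dirDeriv_expExtension_fst (hf : ContDiff ℝ ∞ f) (y : E) (ℓ : E →L[ℝ] ℝ)
    (l : List (ℝ × E)) (p : ℝ × E) :
    (dirDeriv (expExtension f y ℓ) l p).1 =
      (l.map fun v => ℓ v.2).prod * Real.exp (ℓ (p.2 - y)) := by
  induction l generalizing p with
  | nil => simp [dirDeriv, expExtension]
  | cons v l ih =>
    have hfst : HasFDerivAt (fun p => (dirDeriv (expExtension f y ℓ) l p).1)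
        ((ContinuousLinearMap.fst ℝ ℝ E).comp (fderiv ℝ (dirDeriv (expExtension f y ℓ) l) p)) p :=
      (ContinuousLinearMap.fst ℝ ℝ E).hasFDerivAt.comp p
        ((dirDeriv_smooth (contDiff_expExtension hf y ℓ) l).differentiable (by simp) p).hasFDerivAt
    have hexp : HasFDerivAt (fun p : ℝ × E => ℓ (p.2 - y))
        (ℓ.comp (ContinuousLinearMap.snd ℝ ℝ E)) p :=
      ℓ.hasFDerivAt.comp p (hasFDerivAt_snd.sub_const y)
    simp only [ih] at hfst
    calc (dirDeriv (expExtension f y ℓ) (v :: l) p).1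
        = (l.map fun v => ℓ v.2).prod * (Real.exp (ℓ (p.2 - y)) * ℓ v.2) :=
          DFunLike.congr_fun (hfst.unique (hexp.exp.const_mul _)) v
      _ = ((v :: l).map fun v => ℓ v.2).prod * Real.exp (ℓ (p.2 - y)) := by
          rw [List.map_cons, List.prod_cons]
          ring

end Semiconj

/-- The functions `τ ↦ ℓ(F(τ)(y))` on trees, where `F` are the elementary differentials of a smooth
vector field on a finite-dimensional space, `y` is a point and `ℓ` is a linear form. They are
described on planar representatives, `elemDiff` being restricted to `ℝᴺ`. -/
def observables : Submodule ℝ (RTree → ℝ) where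
  carrier := {w | ∃ (E : Type) (_ : NormedAddCommGroup E) (_ : NormedSpace ℝ E)
    (_ : FiniteDimensional ℝ E) (f : E → E) (y : E) (ℓ : E →L[ℝ] ℝ),
    ContDiff ℝ ∞ f ∧ ∀ t, w (RTree.mk t) = ℓ (PTree.elem f t y)}
  zero_mem' := ⟨ℝ, inferInstance, inferInstance, inferInstance, fun _ => 0, 0, 0, contDiff_const,
    fun _ => rfl⟩
  add_mem' := by
    rintro w w' ⟨E, _, _, _, f, y, ℓ, hf, hw⟩ ⟨E', _, _, _, f', y', ℓ', hf', hw'⟩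
    refine ⟨E × E', inferInstance, inferInstance, inferInstance, Prod.map f f', (y, y'),
      ℓ.comp (.fst ℝ E E') + ℓ'.comp (.snd ℝ E E'), hf.prodMap hf', fun t => ?_⟩
    have hfst := semiconj_elem (hf.prodMap hf') hf
      (A := ContinuousLinearMap.fst ℝ E E') (fun _ => rfl) t (y, y')
    have hsnd := semiconj_elem (hf.prodMap hf') hf'
      (A := ContinuousLinearMap.snd ℝ E E') (fun _ => rfl) t (y, y')
    rw [Pi.add_apply, hw, hw', _root_.add_apply, ContinuousLinearMap.comp_apply,
      ContinuousLinearMap.comp_apply, hfst, hsnd]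
    rfl
  smul_mem' := by
    rintro r w ⟨E, _, _, _, f, y, ℓ, hf, hw⟩
    exact ⟨E, inferInstance, inferInstance, inferInstance, f, y, r • ℓ, hf, fun t => by simp [hw]⟩

theorem graft_mem_observables (b : RTree → ℝ) (hb : b ∈ observables) : graft b ∈ observables := by
  obtain ⟨E, _, _, _, f, y, ℓ, hf, hb⟩ := hb
  have hext := contDiff_expExtension hf y ℓ
  have hsnd := semiconj_elem hext hf (A := ContinuousLinearMap.snd ℝ ℝ E) fun _ => rfl
  refine ⟨ℝ × E, inferInstance, inferInstance, inferInstance, expExtension f y ℓ, (0, y),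
    .fst ℝ ℝ E, hext, ?_⟩
  rintro ⟨ts⟩
  calc graft b (RTree.mk (.node ts))
      = (ts.map fun t => ℓ (PTree.elem (expExtension f y ℓ) t (0, y)).2).prod := by
        rw [graft, RTree.children_mk, Multiset.map_coe, Multiset.prod_coe, List.map_map]
        refine congrArg _ (List.map_congr_left fun t _ => ?_)
        exact (hb t).trans (congrArg ℓ (hsnd t (0, y)).symm)
    _ = (PTree.elem (expExtension f y ℓ) (.node ts) (0, y)).1 := by
        simp only [PTree.elem, derivApply_eq_dirDeriv hext, PTree.elemList_eq_map,
          dirDeriv_expExtension_fst hf, sub_self, map_zero, Real.exp_zero, mul_one, List.map_map]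
        rfl

theorem exists_elemDiff_eq (k : ℕ) (a : RTree → ℝ) :
    ∃ (N : ℕ) (f : VectorField N) (y : EuclideanSpace ℝ (Fin N))
      (ℓ : EuclideanSpace ℝ (Fin N) →L[ℝ] ℝ),
      ∀ τ : RTree, τ.size ≤ k → ℓ (elemDiff f τ y) = a τ := by
  obtain ⟨w, ⟨E, _, _, _, f, y, ℓ, hf, hw⟩, hwa⟩ :=
    exists_mem_eq_of_graft_mem observables graft_mem_observables k a
  let L : E ≃L[ℝ] EuclideanSpace ℝ (Fin (Module.finrank ℝ E)) := toEuclidean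
  let g : VectorField (Module.finrank ℝ E) :=
    ⟨fun x => L (f (L.symm x)), L.contDiff.comp (hf.comp L.symm.contDiff)⟩
  refine ⟨_, g, L y, ℓ.comp (L.symm : _ →L[ℝ] E), ?_⟩
  rintro ⟨t⟩ ht
  have hconj : L.symm (PTree.elem g.toFun t (L y)) = PTree.elem f t (L.symm (L y)) :=
    semiconj_elem g.smooth hf (A := (L.symm : _ →L[ℝ] E)) (fun _ => by simp [g]) t (L y)
  rw [L.symm_apply_apply] at hconj
  calc ℓ (L.symm (PTree.elem g.toFun t (L y))) = w (RTree.mk t) := by rw [hconj, hw]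
    _ = a (RTree.mk t) := hwa _ ht

theorem bSeries_injective : Function.Injective bSeries := by
  classical
  intro φ ψ h
  refine values.injective (funext fun τ => ?_)
  obtain ⟨N, f, y, ℓ, hℓ⟩ := exists_elemDiff_eq τ.size (Pi.single τ 1)
  have hcoeff : ∀ χ : Character,
      ℓ ((bSeries χ N f).coeff τ.size y) = values χ τ / (τ.sigma : ℝ) := by
    intro χ
    simp only [bSeries, τ.size_pos.ne', if_false, map_sum, map_smul, smul_eq_mul]
    rw [Finset.sum_eq_single τ]
    · simp [hℓ τ le_rfl, values_apply]
    · intro θ hθ hne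
      rw [hℓ θ (mem_treesOfSize.mp hθ).le, Pi.single_eq_of_ne hne, mul_zero]
    · simp
  have hsigma : (τ.sigma : ℝ) ≠ 0 := Nat.cast_ne_zero.mpr τ.sigma_ne_zero
  rw [← div_left_inj' hsigma, ← hcoeff, ← hcoeff, h]

/-! ### The Butcher group -/

theorem bSeries_counit : bSeries counit = 1 := by
  funext N f
  ext n y : 3
  change (bSeries counit N f).coeff n y = FormalMap.one.coeff n y
  by_cases hn : n = 0 <;> simp [bSeries, FormalMap.one, counit, hn]

theorem conv_assoc (φ₁ φ₂ φ₃ : Character) :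
    conv (conv φ₁ φ₂) φ₃ = conv φ₁ (conv φ₂ φ₃) :=
  bSeries_injective (by simp only [bSeries_conv, mul_assoc])

theorem counit_conv (φ : Character) : conv counit φ = φ :=
  bSeries_injective (by rw [bSeries_conv, bSeries_counit, mul_one])

theorem existsUnique_eq_of_wellFounded {α β : Type*} [Nonempty β] {r : α → α → Prop}
    (hr : WellFounded r) (G : (α → β) → α → β)
    (hG : ∀ {a a' x}, (∀ y, r y x → a y = a' y) → G a x = G a' x) : ∃! a, G a = a := by
  classical
  let F (x : α) (rec : ∀ y, r y x → β) : β :=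
    G (fun y => if h : r y x then rec y h else Classical.arbitrary β) x
  have hF (a : α → β) (x : α) : F x (fun y _ => a y) = G a x := hG fun y hy => dif_pos hy
  refine ⟨hr.fix F, funext fun x => ?_, fun a ha => funext fun x => ?_⟩
  · rw [hr.fix_eq, hF]
  · induction x using hr.induction with
    | h x ih => rw [hr.fix_eq, hF, ← congrFun ha x, hG ih]

theorem existsUnique_conv_self_eq (ψ : Character) : ∃! χ : Character, conv χ χ = ψ := by
  have hroot : ∃! a : RTree → ℝ, (fun τ => (values ψ τ - properCutSum a a τ) / 2) = a :=
    existsUnique_eq_of_wellFounded RTree.wellFounded_size_lt _ fun h => by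
      rw [properCutSum_congr h h]
  refine (values.existsUnique_congr fun χ => ?_).mpr hroot
  simp only [← values.injective.eq_iff, values_conv, funext_iff, Pi.add_apply,
    cutSum_eq_add_properCutSum]
  refine forall_congr' fun τ => ?_
  constructor <;> intro h <;> linarith

theorem exists_conv_eq_counit (φ : Character) : ∃ χ : Character, conv χ φ = counit := by
  obtain ⟨a, ha, -⟩ := existsUnique_eq_of_wellFounded RTree.wellFounded_size_lt
    (fun a τ => -(values φ τ + properCutSum a (values φ) τ)) fun h => by
      rw [properCutSum_congr h fun _ _ => rfl]
  obtain ⟨χ, rfl⟩ := values.surjective a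
  refine ⟨χ, values.injective (funext fun τ => ?_)⟩
  rw [values_conv, values_counit, Pi.add_apply, cutSum_eq_add_properCutSum, ← congrFun ha τ,
    neg_add_cancel, Pi.zero_apply]

/-- The Butcher group. -/
instance : Group Character :=
  letI : Mul Character := ⟨conv⟩
  letI : One Character := ⟨counit⟩
  letI : Inv Character := ⟨fun φ => (exists_conv_eq_counit φ).choose⟩
  Group.ofLeftAxioms conv_assoc counit_conv fun φ => (exists_conv_eq_counit φ).choose_spec

theorem bSeries_mul (φ ψ : Character) : bSeries (φ * ψ) = bSeries ψ * bSeries φ :=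
  bSeries_conv φ ψ

theorem bSeries_one : bSeries 1 = 1 := bSeries_counit

theorem bar_mul (φ ψ : Character) : bar (φ * ψ) = bar φ * bar ψ := bar_conv φ ψ

theorem bar_inv (φ : Character) : bar φ⁻¹ = (bar φ)⁻¹ := map_inv (MonoidHom.mk' bar bar_mul) φ

/-! ### Adjoint and symmetric methods -/

/-- The anti-involution `φ ↦ (bar φ)⁻¹` of the Butcher group. By `isAdjoint_bSeries_iff` it
corresponds to passing to the adjoint method. -/
instance : StarMul Character where
  star φ := (bar φ)⁻¹
  star_involutive φ := by
    change (bar (bar φ)⁻¹)⁻¹ = φ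
    rw [bar_inv, bar_bar, inv_inv]
  star_mul φ ψ := by rw [bar_mul, mul_inv_rev]

theorem star_eq_inv_bar (φ : Character) : star φ = (bar φ)⁻¹ := rfl

theorem isOdd_iff_isSelfAdjoint {φ : Character} : IsOdd φ ↔ IsSelfAdjoint φ := by
  change φ * bar φ = 1 ∧ bar φ * φ = 1 ↔ (bar φ)⁻¹ = φ
  rw [mul_eq_one_iff_eq_inv, mul_eq_one_iff_inv_eq, and_iff_right_of_imp Eq.symm]

theorem bSeries_bar {N : ℕ} (f : VectorField N) (φ : Character) :
    bSeries (bar φ) N f = (bSeries φ N f).reverse := by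
  ext n y : 3
  simp only [bSeries, FormalMap.reverse, ← values_apply]
  split_ifs with hn
  · rw [hn, pow_zero, one_smul]
  · rw [Finset.smul_sum]
    refine Finset.sum_congr rfl fun τ hτ => ?_
    rw [values_bar, mem_treesOfSize.mp hτ, smul_smul, mul_div_assoc]

theorem isAdjoint_bSeries_iff_mul_eq_one {φ : Character} {X : Method} :
    (bSeries φ).IsAdjoint X ↔ X * bSeries (bar φ) = 1 ∧ bSeries (bar φ) * X = 1 := by
  have eq_one_iff (A : Method) : (∀ N f, A N f = FormalMap.one) ↔ A = 1 :=
    ⟨fun h => funext fun N => funext (h N), by rintro rfl _ _; rfl⟩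
  simp only [Method.IsAdjoint, FormalMap.IsAdjoint, ← bSeries_bar, forall_and]
  exact and_congr (eq_one_iff (X * bSeries (bar φ))) (eq_one_iff (bSeries (bar φ) * X))

theorem isAdjoint_bSeries_iff {φ : Character} {X : Method} :
    (bSeries φ).IsAdjoint X ↔ X = bSeries (star φ) := by
  have hleft : bSeries (star φ) * bSeries (bar φ) = 1 := by
    rw [← bSeries_mul, star_eq_inv_bar, mul_inv_cancel, bSeries_one]
  have hright : bSeries (bar φ) * bSeries (star φ) = 1 := by
    rw [← bSeries_mul, star_eq_inv_bar, inv_mul_cancel, bSeries_one]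
  rw [isAdjoint_bSeries_iff_mul_eq_one]
  constructor
  · rintro ⟨hX, -⟩
    exact left_inv_eq_right_inv hX hright
  · rintro rfl
    exact ⟨hleft, hright⟩

theorem isSymmetric_bSeries_iff {φ : Character} :
    (bSeries φ).IsSymmetric ↔ IsSelfAdjoint φ := by
  rw [Method.IsSymmetric, isAdjoint_bSeries_iff, bSeries_injective.eq_iff, isSelfAdjoint_iff,
    eq_comm]

theorem isSelfAdjoint_of_conv_self {χ : Character} (h : IsSelfAdjoint (conv χ χ)) :
    IsSelfAdjoint χ :=
  (existsUnique_conv_self_eq _).unique ((star_mul χ χ).symm.trans h) rfl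

end BSeries

end

open BSeries in
theorem mainTheorem2 (ψ : Character) :
    -- `Ψ` is symmetric if and only if `Ψ = Ω ∘ Ω*` for some B-series method `Ω`
    ((bSeries ψ).IsSymmetric ↔
      ∃ (ω : Character) (Ωs : Method), (bSeries ω).IsAdjoint Ωs ∧
        bSeries ψ = (bSeries ω).comp Ωs) ∧
    -- the character has a unique square root in the Butcher group
    (∃! χ : Character, conv χ χ = ψ) ∧
    -- if `Ψ` is symmetric, this square root is odd and one may take `Ω` to be its B-series method
    ((bSeries ψ).IsSymmetric → ∀ χ : Character, conv χ χ = ψ →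
      IsOdd χ ∧ (bSeries χ).IsSymmetric ∧
        ∃ Ωs : Method, (bSeries χ).IsAdjoint Ωs ∧ bSeries ψ = (bSeries χ).comp Ωs) := by
  have hroot : (bSeries ψ).IsSymmetric → ∀ χ : Character, conv χ χ = ψ →
      IsOdd χ ∧ (bSeries χ).IsSymmetric ∧
        ∃ Ωs : Method, (bSeries χ).IsAdjoint Ωs ∧ bSeries ψ = (bSeries χ).comp Ωs := by
    rintro hψ χ rfl
    have hχ : IsSelfAdjoint χ := isSelfAdjoint_of_conv_self (isSymmetric_bSeries_iff.mp hψ)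
    have hsymm : (bSeries χ).IsSymmetric := isSymmetric_bSeries_iff.mpr hχ
    exact ⟨isOdd_iff_isSelfAdjoint.mpr hχ, hsymm, bSeries χ, hsymm, bSeries_conv χ χ⟩
  refine ⟨⟨fun hψ => ?_, ?_⟩, existsUnique_conv_self_eq ψ, hroot⟩
  · obtain ⟨χ, hχ⟩ := (existsUnique_conv_self_eq ψ).exists
    exact ⟨χ, (hroot hψ χ hχ).2.2⟩
  · rintro ⟨ω, Ωs, hΩs, hψ⟩
    have hψω : bSeries ψ = bSeries (star ω * ω) := by
      rw [bSeries_mul, ← isAdjoint_bSeries_iff.mp hΩs]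
      exact hψ
    rw [isSymmetric_bSeries_iff, bSeries_injective hψω]
    exact IsSelfAdjoint.star_mul_self ω
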